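/- A von Neumann algebra acting on a Hilbert space $\mathcal H$ is a unital $*$-subalgebra $\mathcal M$ of $\mathcal B(\mathcal H)$ that is closed in the weak operator topology (equivalently, equal to its double commutant). $*$-homomorphisms between von Neumann algebras are unital, and a $*$-homomorphism or a linear functional is called normal if its restriction to the unit ball is continuous with respect to the weak operator topologies (respectively, from the weak operator topology to $\mathbb C$). A $W^*$-probability space is a pair $(\mathcal M,\tau)$, where $\mathcal M$ is a von Neumann algebra acting on some Hilbert space and $\tau\colon\mathcal M\to\mathbb C$ is a faithful normal tracial state, i.e. $\tau$ is linear and normal, $\tau(a^*a)>0$ for all $a\ne0$, $\tau(ab)=\tau(ba)$ for all $a,b$, and $\tau(1)=1$. Let $\mathcal S$ be a set equipped with an upward filtering partial order $\le$ (any two elements have a common upper bound), let $(\mathcal M_S,\tau_S)_{S\in\mathcal S}$ be a family of $W^*$-probability spaces, and for all $S\le T$ in $\mathcal S$ let $\Phi_{S,T}\colon\mathcal M_S\to\mathcal M_T$ be a $*$-homomorphism such that $\tau_T\circ\Phi_{S,T}=\tau_S$. Assume that $\Phi_{S,T}\circ\Phi_{R,S}=\Phi_{R,T}$ whenever $R\le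 S\le T$. Then there exist a $W^*$-probability space $(\mathcal M,\tau)$ and injective normal $*$-homomorphisms $\Phi_S\colon\mathcal M_S\to\mathcal M$ $(S\in\mathcal S)$ such that 1. $\tau\circ\Phi_S=\tau_S$ for all $S$ in $\mathcal S$; 2. $\Phi_T\circ\Phi_{S,T}=\Phi_S$ for all $S\le T$ in $\mathcal S$; 3. $\mathcal M$ is generated as a von Neumann algebra by $\bigcup_{S\in\mathcal S}\Phi_S(\mathcal M_S)$, i.e. it is the smallest von Neumann algebra on its Hilbert space that contains this set. These properties characterize $(\mathcal M,\tau)$ up to trace preserving $*$-isomorphism, in the following sense. If $(\mathcal M,\tau)$ with $(\Phi_S)_{S\in\mathcal S}$ and $(\mathcal M',\tau')$ with $(\Phi'_S)_{S\in\mathcal S}$ both consist of a $W^*$-probability space and injective normal $*$-homomorphisms satisfying 1-3, then there is a $*$-isomorphism $\Psi$ of $\mathcal M$ onto $\mathcal M'$ such that $\tau'\circ\Psi=\tau$ and $\Psi\circ\Phi_S=\Phi'_S$ for all $S$ in $\mathcal S$. Conversely, if $(\mathcal M,\tau)$ with $(\Phi_S)_{S\in\mathcal S}$ is as above, $(\mathcal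 M',\tau')$ is a $W^*$-probability space and $\Psi$ is a $*$-isomorphism of $\mathcal M$ onto $\mathcal M'$ such that $\tau'\circ\Psi=\tau$, then the maps $\Psi\circ\Phi_S\colon\mathcal M_S\to\mathcal M'$ are injective normal $*$-homomorphisms and $(\mathcal M',\tau')$ with these maps satisfies 1-3. -/

import Mathlib

universe u v w w'

open scoped ComplexOrder

/-- The weak operator topology on (the elements of) a von Neumann algebra `M` acting on `H`:
the topology induced from the weak operator topology on the bounded operators on `H`. -/
@[reducible] noncomputable def VonNeumannAlgebra.wot {H : Type u} [NormedAddCommGroup H] [InnerProductSpace ℂ H]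
    [CompleteSpace H] (M : VonNeumannAlgebra H) : TopologicalSpace M.toStarSubalgebra :=
  TopologicalSpace.induced
    (fun a => (ContinuousLinearMapWOT.ofCLM (a : H →L[ℂ] H) : H →WOT[ℂ] H)) inferInstance

/-- The closed unit ball of a von Neumann algebra with respect to the operator norm. -/
def VonNeumannAlgebra.unitBall {H : Type u} [NormedAddCommGroup H] [InnerProductSpace ℂ H]
    [CompleteSpace H] (M : VonNeumannAlgebra H) : Set M.toStarSubalgebra :=
  {a | ‖(a : H →L[ℂ] H)‖ ≤ 1}

/-- `M` is generated by the set `X` of operators as a von Neumann algebra: it is the smallest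
von Neumann algebra on `H` that contains `X`. -/
def VonNeumannAlgebra.IsGeneratedBy {H : Type u} [NormedAddCommGroup H] [InnerProductSpace ℂ H]
    [CompleteSpace H] (M : VonNeumannAlgebra H) (X : Set (H →L[ℂ] H)) : Prop :=
  IsLeast {N : VonNeumannAlgebra H | X ⊆ (N : Set (H →L[ℂ] H))} M

/-- A W*-probability space `(M, τ)`: a von Neumann algebra `M` acting on a Hilbert space `H`,
together with a faithful normal tracial state `τ` on `M`. -/
structure WStarProbabilitySpace where
  /-- the Hilbert space on which the algebra acts -/
  H : Type u
  [normedAddCommGroup : NormedAddCommGroup H]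
  [innerProductSpace : InnerProductSpace ℂ H]
  [completeSpace : CompleteSpace H]
  /-- the von Neumann algebra -/
  M : VonNeumannAlgebra H
  /-- the trace -/
  τ : M.toStarSubalgebra →ₗ[ℂ] ℂ
  /-- `τ` is normal: its restriction to the unit ball is continuous for the weak operator
  topology -/
  normal : @ContinuousOn _ _ M.wot _ τ M.unitBall
  /-- `τ` is positive and faithful; the order on `ℂ` is the one for which `0 < z` says that `z` is
  a positive real number -/
  faithful : ∀ a : M.toStarSubalgebra, a ≠ 0 → 0 < τ (star a * a)
  tracial : ∀ a b : M.toStarSubalgebra, τ (a * b) = τ (b * a)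
  map_one : τ 1 = 1

namespace WStarProbabilitySpace

attribute [instance] normedAddCommGroup innerProductSpace completeSpace

/-- The elements of the von Neumann algebra of a W*-probability space, as a type. -/
abbrev Alg (P : WStarProbabilitySpace.{u}) : Type u := P.M.toStarSubalgebra

/-- A (unital) *-homomorphism between von Neumann algebras is normal if its restriction to the unit
ball is continuous with respect to the weak operator topologies. -/
def IsNormal {P : WStarProbabilitySpace.{u}} {Q : WStarProbabilitySpace.{v}}
    (φ : P.Alg →⋆ₐ[ℂ] Q.Alg) : Prop :=
  @ContinuousOn _ _ P.M.wot Q.M.wot φ P.M.unitBall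

/-- The pair `(L, ι)` of a W*-probability space `L` and a family of *-homomorphisms
`ι s : M s → L` is an inductive limit of the family of W*-probability spaces `M` with connecting
maps `Φ s t`, `s ≤ t`. -/
structure IsInductiveLimit {S : Type u} [PartialOrder S] (M : S → WStarProbabilitySpace.{v})
    (Φ : ∀ s t : S, s ≤ t → ((M s).Alg →⋆ₐ[ℂ] (M t).Alg))
    (L : WStarProbabilitySpace.{w}) (ι : ∀ s : S, (M s).Alg →⋆ₐ[ℂ] L.Alg) : Prop where
  injective : ∀ s, Function.Injective (ι s)
  normal : ∀ s, IsNormal (ι s)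
  trace_comp : ∀ s (a : (M s).Alg), L.τ (ι s a) = (M s).τ a
  comp_eq : ∀ s t (hst : s ≤ t), (ι t).comp (Φ s t hst) = ι s
  generates : L.M.IsGeneratedBy (⋃ s, Set.range fun a : (M s).Alg => (ι s a : L.H →L[ℂ] L.H))

end WStarProbabilitySpace

/-! Everything rests on reading a `W*`-probability space inside its `L²`-space. Balls are weak
operator compact, and faithfulness makes the functionals `a ↦ τ (a * c)` separate points, so these
functionals determine the weak operator topology on bounded sets. Hence balls are closed in `L²`,
and a trace preserving `*`-homomorphism is automatically injective, isometric and normal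
(`isNormal_of_trace_comp`).

Existence: the connecting maps are isometric, so the algebraic direct limit carries a tracial state
with bounded left multiplications. The GNS construction gives a Hilbert space, the limit algebra is
the bicommutant of the left multiplications, and its trace is the vector functional of the class of
`1`. The tracial property makes this vector separating, hence the trace faithful.

Uniqueness: the pairs `(ι s a, ι' s a)` form a `*`-algebra `D` on which traces and norms of the two
components agree. A Kaplansky type theorem (`isStrongLimit_unitBall`, `exists_mem_closure_vec`)
shows that every element of either limit is a bounded `L²`-limit of components of `D`. Since the
correspondence is isometric for the `L²`-norm and balls are `L²`-closed, it extends to a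
`*`-isomorphism (`exists_starAlgEquiv`). The union of the ranges need not be norm closed, so the
density theorem asks only for the resolvents `(1 + a²)⁻¹`, which come from the individual algebras.

Transport: generation amounts to bounded `L²`-density, and this passes through a trace preserving
isomorphism even though the Hilbert spaces are unrelated. -/

/-! ### Weak operator compactness and closedness. -/

open Filter Topology in
/-- Closed balls of bounded operators are compact in the weak operator topology. -/
theorem Ultrafilter.exists_weakOperator_limit {H : Type*} [NormedAddCommGroup H]
    [InnerProductSpace ℂ H] [CompleteSpace H] {α : Type*} (U : Ultrafilter α)
    (f : α → H →L[ℂ] H) (C : ℝ) (hf : ∀ᶠ i in U, ‖f i‖ ≤ C) :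
    ∃ T : H →L[ℂ] H, ‖T‖ ≤ C ∧
      ∀ x y : H, Tendsto (fun i => inner ℂ x (f i y)) U (𝓝 (inner ℂ x (T y))) := by
  have hC : 0 ≤ C := by
    obtain ⟨i, hi⟩ := hf.exists
    exact (norm_nonneg _).trans hi
  have bound : ∀ x y : H, ∀ᶠ i in U, ‖inner ℂ (f i x) y‖ ≤ C * ‖x‖ * ‖y‖ := fun x y => by
    filter_upwards [hf] with i hi
    exact (norm_inner_le_norm _ _).trans (mul_le_mul_of_nonneg_right
      ((f i).le_of_opNorm_le hi x) (norm_nonneg _))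
  have key : ∀ x y : H, ∃ z : ℂ, ‖z‖ ≤ C * ‖x‖ * ‖y‖ ∧
      Tendsto (fun i => inner ℂ (f i x) y) U (𝓝 z) := by
    intro x y
    obtain ⟨z, hz, hz'⟩ := (isCompact_closedBall (0 : ℂ) (C * ‖x‖ * ‖y‖)).ultrafilter_le_nhds
      (U.map fun i => inner ℂ (f i x) y) (by
        rw [le_principal_iff, Ultrafilter.coe_map]
        change ∀ᶠ i in U, inner ℂ (f i x) y ∈ Metric.closedBall (0 : ℂ) _
        filter_upwards [bound x y] with i hi
        simpa using hi)
    exact ⟨z, by simpa using hz, hz'⟩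
  -- The pointwise limits inherit sesquilinearity and the bound `C`, so the Riesz theorem turns them
  -- into an operator.
  choose B hB hBlim using key
  let B' : H →L⋆[ℂ] H →L[ℂ] ℂ := LinearMap.mkContinuous₂
    (LinearMap.mk₂'ₛₗ (starRingEnd ℂ) (RingHom.id ℂ) B
      (fun x x' y => tendsto_nhds_unique (hBlim _ _)
        (((hBlim x y).add (hBlim x' y)).congr fun i => by simp))
      (fun c x y => tendsto_nhds_unique (hBlim _ _)
        (((hBlim x y).const_mul (starRingEnd ℂ c)).congr fun i => by simp [mul_comm]))
      (fun x y y' => tendsto_nhds_unique (hBlim _ _)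
        (((hBlim x y).add (hBlim x y')).congr fun i => by simp))
      (fun c x y => tendsto_nhds_unique (hBlim _ _)
        (((hBlim x y).const_mul c).congr fun i => by simp)))
    C (fun x y => hB x y)
  have hT : ∀ x y, inner ℂ (InnerProductSpace.continuousLinearMapOfBilin B' x) y = B x y :=
    fun x y => InnerProductSpace.continuousLinearMapOfBilin_apply B' x y
  refine ⟨InnerProductSpace.continuousLinearMapOfBilin B', ?_, fun x y => ?_⟩
  · refine ContinuousLinearMap.opNorm_le_bound _ hC fun x => ?_
    set v := InnerProductSpace.continuousLinearMapOfBilin B' x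
    have h1 : ‖v‖ * ‖v‖ ≤ C * ‖x‖ * ‖v‖ := by
      rw [← inner_self_eq_norm_mul_norm (𝕜 := ℂ)]
      exact (RCLike.re_le_norm _).trans ((hT x v).symm ▸ hB x v)
    rcases (norm_nonneg v).eq_or_lt with h0 | h0
    · rw [← h0]; positivity
    · exact le_of_mul_le_mul_right h1 h0
  · rw [← inner_conj_symm, hT]
    exact ((hBlim y x).star).congr fun i => inner_conj_symm _ _

namespace VonNeumannAlgebra

variable {H : Type*} [NormedAddCommGroup H] [InnerProductSpace ℂ H] [CompleteSpace H]

open Filter Topology in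
/-- A von Neumann algebra is closed in the weak operator topology. -/
theorem mem_of_weakOperator_limit (M : VonNeumannAlgebra H) {α : Type*} {l : Filter α} [l.NeBot]
    {f : α → H →L[ℂ] H} (hf : ∀ᶠ i in l, f i ∈ M) {T : H →L[ℂ] H}
    (hT : ∀ x y : H, Tendsto (fun i => inner ℂ x (f i y)) l (𝓝 (inner ℂ x (T y)))) : T ∈ M := by
  rw [← SetLike.mem_coe, ← M.centralizer_centralizer]
  intro z hz
  ext y
  refine ext_inner_left ℂ fun x => ?_
  have h1 := hT (star z x) y
  simp only [ContinuousLinearMap.star_eq_adjoint, ContinuousLinearMap.adjoint_inner_left] at h1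
  refine tendsto_nhds_unique h1 ((hT x (z y)).congr' ?_)
  filter_upwards [hf] with i hi
  have := congrArg (fun S : H →L[ℂ] H => S y) (hz _ hi)
  simp only [mul_apply_eq_comp] at this
  rw [this]

end VonNeumannAlgebra

/-! ### Von Neumann's density theorem. -/

section StrongDensity

variable {H : Type*} [NormedAddCommGroup H] [InnerProductSpace ℂ H]

open Filter Topology

/-- `T` is a limit, in the strong operator topology, of a net in `s`. -/
def IsStrongLimit (s : Set (H →L[ℂ] H)) (T : H →L[ℂ] H) : Prop :=
  ∃ l : Filter (H →L[ℂ] H), l.NeBot ∧ s ∈ l ∧ ∀ ξ, Tendsto (fun a => a ξ) l (𝓝 (T ξ))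

theorem IsStrongLimit.exists_near {s : Set (H →L[ℂ] H)} {T : H →L[ℂ] H} (h : IsStrongLimit s T)
    (F : Finset H) {ε : ℝ} (hε : 0 < ε) : ∃ a ∈ s, ∀ ξ ∈ F, ‖a ξ - T ξ‖ < ε := by
  obtain ⟨l, hl, hs, hT⟩ := h
  have h1 : ∀ᶠ a in l, ∀ ξ ∈ F, ‖a ξ - T ξ‖ < ε := by
    rw [Filter.eventually_all_finset]
    intro ξ _
    have := (hT ξ).eventually (Metric.ball_mem_nhds _ hε)
    simpa [dist_eq_norm] using this
  obtain ⟨a, ha, ha'⟩ := (h1.and hs).exists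
  exact ⟨a, ha', ha⟩

theorem isStrongLimit_of_exists_near {s : Set (H →L[ℂ] H)} {T : H →L[ℂ] H}
    (h : ∀ (F : Finset H) (ε : ℝ), 0 < ε → ∃ a ∈ s, ∀ ξ ∈ F, ‖a ξ - T ξ‖ < ε) :
    IsStrongLimit s T := by
  classical
  have h' : ∀ p : Finset H × ℕ, ∃ a ∈ s, ∀ ξ ∈ p.1, ‖a ξ - T ξ‖ < 1 / ((p.2 : ℝ) + 1) :=
    fun p => h p.1 _ Nat.one_div_pos_of_nat
  choose a has ha using h'
  refine ⟨map a atTop, inferInstance, mem_map.2 (Eventually.of_forall has), fun ξ => ?_⟩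
  rw [tendsto_map'_iff, tendsto_iff_norm_sub_tendsto_zero]
  have h1 : Tendsto (fun p : Finset H × ℕ => 1 / ((p.2 : ℝ) + 1)) atTop (𝓝 0) := by
    rw [← prod_atTop_atTop_eq]
    exact tendsto_one_div_add_atTop_nhds_zero_nat.comp tendsto_snd
  refine squeeze_zero' (Eventually.of_forall fun _ => norm_nonneg _) ?_ h1
  filter_upwards [eventually_ge_atTop (({ξ} : Finset H), 0)] with p hp
  exact (ha p ξ (hp.1 (Finset.mem_singleton_self ξ))).le

variable [CompleteSpace H]

/-- **Von Neumann's density theorem**: every operator in the double commutant of a unital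
`*`-algebra is a strong limit of elements of the algebra. -/
theorem StarSubalgebra.isStrongLimit_of_mem_centralizer_centralizer
    (A : StarSubalgebra ℂ (H →L[ℂ] H)) {T : H →L[ℂ] H}
    (hT : T ∈ Set.centralizer (Set.centralizer (A : Set (H →L[ℂ] H)))) :
    IsStrongLimit (A : Set (H →L[ℂ] H)) T := by
  classical
  refine isStrongLimit_of_exists_near fun F ε hε => ?_
  -- Approximating on the finite set `F` means approximating at the single vector `ξ` of the direct
  -- sum of copies of `H` indexed by `F`, with operators acting diagonally.
  let amp : (H →L[ℂ] H) → PiLp 2 (fun _ : F => H) →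
    PiLp 2 (fun _ : F => H) := fun a v => WithLp.toLp 2 fun i => a (v i)
  have amp_cont : ∀ a, Continuous (amp a) := fun a => by
    refine (PiLp.continuous_toLp 2 _).comp (continuous_pi fun i => a.continuous.comp ?_)
    exact (continuous_apply i).comp (PiLp.continuous_ofLp 2 _)
  let ξ : PiLp 2 (fun _ : F => H) := WithLp.toLp 2 fun i => (i : H)
  let K₀ : Submodule ℂ (PiLp 2 (fun _ : F => H)) :=
    { carrier := {v | ∃ a ∈ A, amp a ξ = v}
      add_mem' := by
        rintro _ _ ⟨a, ha, rfl⟩ ⟨b, hb, rfl⟩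
        exact ⟨a + b, add_mem ha hb, rfl⟩
      zero_mem' := ⟨0, zero_mem _, rfl⟩
      smul_mem' := by
        rintro c _ ⟨a, ha, rfl⟩
        exact ⟨c • a, A.smul_mem ha c, rfl⟩ }
  let K := K₀.topologicalClosure
  have hKcl : IsClosed (K : Set (PiLp 2 (fun _ : F => H))) := K₀.isClosed_topologicalClosure
  have : CompleteSpace K := hKcl.completeSpace_coe
  have hinv : ∀ a ∈ A, ∀ v ∈ K, amp a v ∈ K := by
    intro a ha v hv
    refine map_mem_closure (amp_cont a) hv ?_
    rintro _ ⟨b, hb, rfl⟩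
    exact ⟨a * b, mul_mem ha hb, rfl⟩
  have hadj : ∀ (a : H →L[ℂ] H) (v w : PiLp 2 (fun _ : F => H)),
      inner ℂ (amp (star a) v) w = inner ℂ v (amp a w) := by
    intro a v w
    simp [amp, PiLp.inner_apply, ContinuousLinearMap.star_eq_adjoint,
      ContinuousLinearMap.adjoint_inner_left]
  have hinv' : ∀ a ∈ A, ∀ v ∈ Kᗮ, amp a v ∈ Kᗮ := by
    intro a ha v hv
    rw [Submodule.mem_orthogonal] at hv ⊢
    intro u hu
    rw [← hadj]
    exact hv _ (hinv _ (star_mem ha) _ hu)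
  have amp_sub : ∀ a v w, amp a (v - w) = amp a v - amp a w := fun a v w => by
    ext i; simp [amp]
  have hcomm : ∀ a ∈ A, ∀ v, K.starProjection (amp a v) = amp a (K.starProjection v) := by
    intro a ha v
    refine Submodule.eq_starProjection_of_mem_orthogonal
      (hinv a ha _ (Submodule.starProjection_apply_mem K v)) ?_
    rw [← amp_sub]
    exact hinv' a ha _ (Submodule.sub_starProjection_mem_orthogonal v)
  have hξ : K.starProjection ξ = ξ := by
    rw [Submodule.starProjection_eq_self_iff]
    exact subset_closure ⟨1, one_mem _, rfl⟩
  -- The projection onto `K` commutes with the diagonal action of `A`, so its matrix entries lie in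
  -- the commutant of `A`. They therefore commute with `T`, and the diagonal action of `T` preserves
  -- `K`.
  let inc : F → H →L[ℂ] PiLp 2 (fun _ : F => H) := fun j =>
    (PiLp.continuousLinearEquiv 2 ℂ (fun _ : F => H)).symm.toContinuousLinearMap ∘L
      ContinuousLinearMap.single ℂ (fun _ : F => H) j
  let prj : F → PiLp 2 (fun _ : F => H) →L[ℂ] H := fun i => PiLp.proj 2 (fun _ : F => H) i
  have hsum : ∀ v : PiLp 2 (fun _ : F => H), ∑ j, inc j (v j) = v := by
    intro v
    ext i
    change prj i (∑ j, inc j (v j)) = _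
    rw [map_sum, Finset.sum_eq_single i]
    · simp [inc, prj]
    · intro j _ hj
      simp [inc, prj, hj.symm]
    · simp
  have amp_inc : ∀ a j x, amp a (inc j x) = inc j (a x) := by
    intro a j x
    ext i
    by_cases h : i = j
    · subst h; simp [amp, inc]
    · simp [amp, inc, h]
  have hp : ∀ i j, (prj i ∘L K.starProjection ∘L inc j) * T =
      T * (prj i ∘L K.starProjection ∘L inc j) := by
    intro i j
    refine hT _ fun a ha => ?_
    ext x
    have := congrArg (prj i) (hcomm a ha (inc j x))
    rw [amp_inc] at this
    exact this.symm
  have hexp : ∀ v i, K.starProjection v i = ∑ j, (prj i ∘L K.starProjection ∘L inc j) (v j) := by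
    intro v i
    have := congrArg (fun w => prj i (K.starProjection w)) (hsum v)
    simp only [map_sum] at this
    exact this.symm
  have hTξ : amp T ξ ∈ K := by
    rw [← Submodule.starProjection_eq_self_iff]
    ext i
    have h1 : ∀ j, (prj i ∘L K.starProjection ∘L inc j) (amp T ξ j) =
        T ((prj i ∘L K.starProjection ∘L inc j) (ξ j)) := fun j =>
      congrArg (fun S : H →L[ℂ] H => S (ξ j)) (hp i j)
    rw [hexp, Finset.sum_congr rfl fun j _ => h1 j, ← map_sum, ← hexp, hξ]
  obtain ⟨_, ⟨a, ha, rfl⟩, hlt⟩ := Metric.mem_closure_iff.1 hTξ ε hε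
  refine ⟨a, ha, fun x hx => ?_⟩
  rw [dist_comm, dist_eq_norm] at hlt
  exact (PiLp.norm_apply_le (amp a ξ - amp T ξ) ⟨x, hx⟩).trans_lt hlt

end StrongDensity

/-! ### Bounded strong density in the manner of Kaplansky. -/

section RealSubspace

variable {E : Type*} [NormedAddCommGroup E] [InnerProductSpace ℂ E] [CompleteSpace E]

/-- Self-adjoint operators form only a real subspace, so the double orthogonal complement is taken
for the real inner product `re ⟪x, y⟫`. -/
theorem mem_closure_of_re_inner_eq_zero (V : AddSubgroup E)
    (hV : ∀ (r : ℝ), ∀ v ∈ V, (r : ℂ) • v ∈ V) (x : E)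
    (h : ∀ η : E, (∀ v ∈ V, (inner ℂ η v).re = 0) → (inner ℂ η x).re = 0) :
    x ∈ closure (V : Set E) := by
  let _ : InnerProductSpace ℝ E := InnerProductSpace.rclikeToReal ℂ E
  let W : Submodule ℝ E :=
    { V with smul_mem' := fun r v hv => hV r v hv }
  have hW : x ∈ W.topologicalClosure := by
    rw [← Submodule.orthogonal_orthogonal_eq_closure (𝕜 := ℝ) (E := E) W, Submodule.mem_orthogonal]
    intro η hη
    rw [Submodule.mem_orthogonal'] at hη
    rw [real_inner_eq_re_inner ℂ]
    refine h η fun v hv => ?_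
    have := hη v hv
    rwa [real_inner_eq_re_inner ℂ] at this
  exact hW

end RealSubspace

/-- Expanding the square gives `‖ξ‖² + 2‖aξ‖² + ‖a²ξ‖²`, and `‖aξ‖² ≤ ‖ξ‖ ‖a²ξ‖` by Cauchy–Schwarz.
The estimates say that `(1 + a²)⁻¹` and `2a(1 + a²)⁻¹` are contractions once the inverse exists. -/
theorem ContinuousLinearMap.norm_le_norm_one_add_sq {H : Type*} [NormedAddCommGroup H]
    [InnerProductSpace ℂ H] {a : H →L[ℂ] H} (ha : ∀ x y, inner ℂ (a x) y = inner ℂ x (a y))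
    (ξ : H) :
    ‖ξ‖ ≤ ‖ξ + a (a ξ)‖ ∧ 2 * ‖a ξ‖ ≤ ‖ξ + a (a ξ)‖ := by
  have h : ‖ξ + a (a ξ)‖ ^ 2 = ‖ξ‖ ^ 2 + 2 * ‖a ξ‖ ^ 2 + ‖a (a ξ)‖ ^ 2 := by
    rw [@norm_add_sq ℂ, ← ha, inner_self_eq_norm_sq_to_K]
    norm_cast
  have h' : ‖a ξ‖ ^ 2 ≤ ‖ξ‖ * ‖a (a ξ)‖ := by
    have := norm_inner_le_norm (𝕜 := ℂ) ξ (a (a ξ))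
    rw [← ha, inner_self_eq_norm_sq_to_K] at this
    simpa using this
  constructor
  · refine le_of_sq_le_sq ?_ (norm_nonneg _)
    rw [h]; nlinarith [sq_nonneg ‖a ξ‖, sq_nonneg ‖a (a ξ)‖]
  · refine le_of_sq_le_sq ?_ (norm_nonneg _)
    rw [h]; nlinarith [sq_nonneg (‖ξ‖ - ‖a (a ξ)‖)]

section StrongDensity

variable {H : Type*} [NormedAddCommGroup H] [InnerProductSpace ℂ H] [CompleteSpace H]

open Filter Topology

/-- A self-adjoint element of the double commutant is a strong limit of self-adjoint elements. -/
theorem StarSubalgebra.isStrongLimit_isSelfAdjoint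
    (A : StarSubalgebra ℂ (H →L[ℂ] H)) {T : H →L[ℂ] H} (hTsa : IsSelfAdjoint T)
    (hT : IsStrongLimit (A : Set (H →L[ℂ] H)) T) :
    IsStrongLimit {a | a ∈ A ∧ IsSelfAdjoint a} T := by
  classical
  refine isStrongLimit_of_exists_near fun F ε hε => ?_
  obtain ⟨l, hl, hAl, hTl⟩ := hT
  let V : AddSubgroup (PiLp 2 (fun _ : F => H)) :=
    { carrier := {v | ∃ a ∈ A, IsSelfAdjoint a ∧ v = WithLp.toLp 2 fun i : F => a i}
      add_mem' := by
        rintro _ _ ⟨a, ha, ha', rfl⟩ ⟨b, hb, hb', rfl⟩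
        exact ⟨a + b, add_mem ha hb, ha'.add hb', rfl⟩
      zero_mem' := ⟨0, zero_mem _, .zero _, rfl⟩
      neg_mem' := by
        rintro _ ⟨a, ha, ha', rfl⟩
        exact ⟨-a, neg_mem ha, ha'.neg, rfl⟩ }
  have hmem : (WithLp.toLp 2 fun i : F => T i) ∈ closure (V : Set (PiLp 2 (fun _ : F => H))) := by
    refine mem_closure_of_re_inner_eq_zero V ?_ _ fun η hη => ?_
    · rintro r _ ⟨a, ha, ha', rfl⟩
      refine ⟨(r : ℂ) • a, A.smul_mem ha _, ?_, rfl⟩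
      rw [isSelfAdjoint_iff, star_smul, ha'.star_eq]
      simp
    -- The adjoint is not strongly continuous, so `a + star a` cannot be passed to the limit
    -- directly. Moving the adjoint across the inner product leaves an expression that is strongly
    -- continuous in `a`.
    · have h1 : ∀ a ∈ A, (∑ i : F, (inner ℂ (η i) (a i) + inner ℂ (a (η i)) (i : H))).re = 0 := by
        intro a ha
        have := hη _ ⟨a + star a, add_mem ha (star_mem ha), .add_star_self a, rfl⟩
        simpa [PiLp.inner_apply, inner_add_right, ContinuousLinearMap.star_eq_adjoint,
          ContinuousLinearMap.adjoint_inner_right] using this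
      have h2 : Tendsto (fun a : H →L[ℂ] H =>
          (∑ i : F, (inner ℂ (η i) (a i) + inner ℂ (a (η i)) (i : H))).re) l
          (𝓝 (∑ i : F, (inner ℂ (η i) (T i) + inner ℂ (T (η i)) (i : H))).re) :=
        (Complex.continuous_re.tendsto _).comp (tendsto_finsetSum _ fun i _ =>
          (tendsto_const_nhds.inner (hTl _)).add ((hTl _).inner tendsto_const_nhds))
      have h3 := tendsto_nhds_unique h2 (tendsto_const_nhds.congr' (by
        filter_upwards [hAl] with a ha using (h1 a ha).symm))
      have h4 : ∀ i : F, inner ℂ (T (η i)) (i : H) = inner ℂ (η i) (T i) := fun i => by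
        rw [← ContinuousLinearMap.adjoint_inner_right, ← ContinuousLinearMap.star_eq_adjoint,
          hTsa.star_eq]
      simp only [h4, ← two_mul, ← Finset.mul_sum] at h3
      simpa [PiLp.inner_apply] using h3
  obtain ⟨_, ⟨a, ha, ha', rfl⟩, hlt⟩ := Metric.mem_closure_iff.1 hmem ε hε
  refine ⟨a, ⟨ha, ha'⟩, fun x hx => ?_⟩
  rw [dist_comm, dist_eq_norm] at hlt
  exact (PiLp.norm_apply_le ((WithLp.toLp 2 fun i : F => a i) - WithLp.toLp 2 fun i : F => T i)
    ⟨x, hx⟩).trans_lt hlt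

/-- The preimage of a self-adjoint contraction under `t ↦ 2 t / (1 + t ^ 2)`. -/
theorem IsSelfAdjoint.exists_two_mul_eq {T : H →L[ℂ] H} (hT : IsSelfAdjoint T) (hT1 : ‖T‖ ≤ 1) :
    ∃ g : ℝ → ℝ, 2 * cfc g T = T * (1 + cfc g T * cfc g T) := by
  -- The continuous right inverse on `[-1, 1]` of `t ↦ 2t / (1 + t²)`.
  let g : ℝ → ℝ := fun t => t / (1 + √(1 - t ^ 2))
  have hg : Continuous g := by
    refine continuous_id.div (by fun_prop) fun t => ?_
    positivity
  refine ⟨g, ?_⟩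
  have hs : ∀ t ∈ spectrum ℝ T, |t| ≤ 1 := fun t ht =>
    (spectrum.norm_le_norm_mul_of_mem ht).trans (mul_le_one₀ hT1 (norm_nonneg _)
      ContinuousLinearMap.norm_id_le)
  have h1 : cfc (fun t => 2 * g t) T = cfc (fun t => t * (1 + g t * g t)) T := by
    refine cfc_congr fun t ht => ?_
    have h0 : 0 ≤ 1 - t ^ 2 := by
      have := sq_le_one_iff_abs_le_one t |>.2 (hs t ht)
      linarith
    have h2 := Real.sq_sqrt h0
    have h3 : 0 < 1 + √(1 - t ^ 2) := by positivity
    simp only [g]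
    field_simp
    linear_combination (-t) * h2
  rw [cfc_const_mul 2 g T hg.continuousOn, cfc_mul (fun t => t) _ T (by fun_prop) (by fun_prop),
    cfc_add _ _ _ (by fun_prop) (by fun_prop), cfc_mul _ _ T (by fun_prop) (by fun_prop)] at h1
  rw [cfc_id' ℝ T, cfc_const_one ℝ T] at h1
  rw [← h1]
  simp [two_smul, two_mul]

/-- A bounded version of strong density in the manner of Kaplansky, for `*`-algebras containing
the resolvents `(1 + a²)⁻¹` of their self-adjoint elements. -/
theorem StarSubalgebra.isStrongLimit_unitBall
    (A : StarSubalgebra ℂ (H →L[ℂ] H))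
    (hA : ∀ a ∈ A, IsSelfAdjoint a → ∃ r ∈ A, (1 + a * a) * r = 1)
    {T : H →L[ℂ] H} (hTsa : IsSelfAdjoint T) (hT1 : ‖T‖ ≤ 1)
    (hT : T ∈ Set.centralizer (Set.centralizer (A : Set (H →L[ℂ] H)))) :
    IsStrongLimit {a | a ∈ A ∧ ‖a‖ ≤ 1} T := by
  classical
  obtain ⟨g, hg⟩ := hTsa.exists_two_mul_eq hT1
  set y := cfc g T with hy
  have hysa : IsSelfAdjoint y := cfc_predicate g T
  have hyA : y ∈ Set.centralizer (Set.centralizer (A : Set (H →L[ℂ] H))) := by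
    intro z hz
    have hz' : Commute T z := (hT z hz).symm
    exact (hz'.cfc_real g).symm.eq
  have hinv : ∃ q : H →L[ℂ] H, (1 + y * y) * q = 1 := by
    refine ⟨cfc (fun t : ℝ => (1 + t * t)⁻¹) y, ?_⟩
    have hpos : ∀ t : ℝ, 1 + t * t ≠ 0 := fun t => by nlinarith [mul_self_nonneg t]
    have h1 : 1 + y * y = cfc (fun t : ℝ => 1 + t * t) y := by
      rw [cfc_add _ _ _ (by fun_prop) (by fun_prop), cfc_mul _ _ y (by fun_prop) (by fun_prop),
        cfc_id' ℝ y, cfc_const_one ℝ y]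
    rw [h1, ← cfc_mul (fun t : ℝ => 1 + t * t) (fun t : ℝ => (1 + t * t)⁻¹) y (by fun_prop)
      (Continuous.inv₀ (by fun_prop) hpos).continuousOn]
    rw [← cfc_const_one ℝ y]
    exact cfc_congr fun t _ => mul_inv_cancel₀ (hpos t)
  obtain ⟨q, hq⟩ := hinv
  refine isStrongLimit_of_exists_near fun F ε hε => ?_
  -- With `r = (1 + a²)⁻¹`, the approximant of `T = 2y(1 + y²)⁻¹` is `2ar`. Its error at `ξ`
  -- involves `a - y` only at `q ξ` and `y (q ξ)`.
  obtain ⟨a, ⟨haA, hasa⟩, ha⟩ := (A.isStrongLimit_isSelfAdjoint hysa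
    (A.isStrongLimit_of_mem_centralizer_centralizer hyA)).exists_near
    (F.image q ∪ F.image fun ξ => y (q ξ)) (ε := ε / 3) (by positivity)
  have hsym : ∀ x z, inner ℂ (a x) z = inner ℂ x (a z) := fun x z => by
    rw [← ContinuousLinearMap.adjoint_inner_right, ← ContinuousLinearMap.star_eq_adjoint,
      hasa.star_eq]
  obtain ⟨r, hrA, hr⟩ := hA a haA hasa
  have hr' : ∀ ξ, r ξ + a (a (r ξ)) = ξ := fun ξ => by
    simpa using congrArg (fun S : H →L[ℂ] H => S ξ) hr
  have hrnorm : ∀ ξ, ‖r ξ‖ ≤ ‖ξ‖ ∧ 2 * ‖a (r ξ)‖ ≤ ‖ξ‖ := fun ξ => by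
    have := ContinuousLinearMap.norm_le_norm_one_add_sq hsym (r ξ)
    rwa [hr'] at this
  have hinj : ∀ ξ ζ, ξ + a (a ξ) = ζ → r ζ = ξ := by
    intro ξ ζ h
    have h1 := (ContinuousLinearMap.norm_le_norm_one_add_sq hsym (r ζ - ξ)).1
    have h2 : (r ζ - ξ) + a (a (r ζ - ξ)) = 0 := by
      rw [map_sub, map_sub, sub_add_sub_comm, hr', h, sub_self]
    rw [h2, norm_zero] at h1
    exact sub_eq_zero.1 (norm_le_zero_iff.1 h1)
  have hcomm : ∀ ξ, r (a ξ) = a (r ξ) := fun ξ => hinj _ _ (by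
    rw [← map_add, hr'])
  refine ⟨(2 : ℂ) • (a * r), ⟨A.smul_mem (mul_mem haA hrA) _, ?_⟩, fun ξ hξ => ?_⟩
  · refine ContinuousLinearMap.opNorm_le_bound _ zero_le_one fun ξ => ?_
    simpa [norm_smul] using (hrnorm ξ).2
  · set η := q ξ with hη
    have hξη : ξ = η + y (y η) := by
      simpa using (congrArg (fun S : H →L[ℂ] H => S ξ) hq).symm
    have hTξ : T ξ = (2 : ℂ) • y η := by
      have := congrArg (fun S : H →L[ℂ] H => S η) hg
      rw [hξη]
      simpa [two_mul, two_smul, eq_comm] using this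
    have h1 : ‖a η - y η‖ < ε / 3 := ha η (by
      simp only [Finset.mem_union, Finset.mem_image]; exact .inl ⟨ξ, hξ, rfl⟩)
    have h2 : ‖a (y η) - y (y η)‖ < ε / 3 := ha (y η) (by
      simp only [Finset.mem_union, Finset.mem_image]; exact .inr ⟨ξ, hξ, rfl⟩)
    -- A resolvent identity: the difference `a - y` appears only behind the contractions `r` and
    -- `2ar`, so no bound on `‖a‖` is needed.
    have h3 : a (r ξ) - y η = r (a η - y η) - a (r (a (y η) - y (y η))) := by
      have e1 : y η = r (y η) + a (a (r (y η))) := (hr' _).symm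
      conv_lhs => rw [e1, hξη]
      simp only [map_add, map_sub, hcomm]
      abel
    have h4 : ((2 : ℂ) • (a * r)) ξ - T ξ = (2 : ℂ) • (a (r ξ) - y η) := by
      rw [hTξ, smul_sub]; rfl
    rw [h4, h3, norm_smul]
    have h5 := norm_sub_le (r (a η - y η)) (a (r (a (y η) - y (y η))))
    have h6 := (hrnorm (a η - y η)).1
    have h7 := (hrnorm (a (y η) - y (y η))).2
    simp only [Complex.norm_ofNat]
    linarith

end StrongDensity

/-! ### The GNS representation of a tracial state. -/

section GNS

variable {A : Type u} [Ring A] [StarRing A] [Algebra ℂ A] [StarModule ℂ A]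

/-- A tracial state on a `*`-algebra, for which left multiplications are bounded with respect to
the seminorm `a ↦ τ (a* a)^(1/2)`. -/
structure IsTracialState (τ : A →ₗ[ℂ] ℂ) : Prop where
  nonneg : ∀ a, 0 ≤ τ (star a * a)
  tracial : ∀ a b, τ (a * b) = τ (b * a)
  map_one : τ 1 = 1
  bounded : ∀ x, ∃ C : ℝ, 0 ≤ C ∧
    ∀ a, (τ (star (x * a) * (x * a))).re ≤ C ^ 2 * (τ (star a * a)).re

namespace IsTracialState

variable {τ : A →ₗ[ℂ] ℂ}

/-- Polarization: `τ (star b * b)` is real for `b = a`, `1 + a` and `1 + I • a`. -/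
theorem map_star (h : IsTracialState τ) (a : A) : τ (star a) = star (τ a) := by
  have h1 := (Complex.nonneg_iff.1 (h.nonneg (1 + a))).2
  have h2 := (Complex.nonneg_iff.1 (h.nonneg (1 + Complex.I • a))).2
  have h3 := (Complex.nonneg_iff.1 (h.nonneg a)).2
  simp only [star_add, star_one, add_mul, mul_add, one_mul, mul_one, map_add, h.map_one,
    Complex.add_im, Complex.one_im, star_smul, smul_mul_smul_comm, map_smul, smul_eq_mul,
    Complex.star_def, Complex.conj_I, neg_mul, Complex.I_mul_I, neg_neg, one_smul, Complex.mul_im,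
    Complex.I_re, Complex.I_im, Complex.neg_im] at h1 h2 h3
  apply Complex.ext
  · simp only [Complex.star_def, Complex.conj_re]; linarith
  · simp only [Complex.star_def, Complex.conj_im]; linarith

/-- A type synonym of `A`, with the inner product `⟪a, b⟫ = τ (a* b)`. -/
@[nolint unusedArguments]
def PreL2 (_ : IsTracialState τ) : Type u := A

variable (h : IsTracialState τ)

instance : AddCommGroup h.PreL2 := inferInstanceAs (AddCommGroup A)
instance : Module ℂ h.PreL2 := inferInstanceAs (Module ℂ A)

/-- The identity map from `A` to its type synonym. -/
def toPreL2 : A ≃ₗ[ℂ] h.PreL2 := LinearEquiv.refl ℂ _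

/-- The inner product on `A` given by `τ`. -/
noncomputable abbrev preL2Core : PreInnerProductSpace.Core ℂ h.PreL2 where
  inner a b := τ (star (h.toPreL2.symm a) * h.toPreL2.symm b)
  conj_inner_symm a b := by
    rw [← Complex.star_def, ← h.map_star]; simp
  re_inner_nonneg _ := (RCLike.nonneg_iff.mp (h.nonneg _)).1
  add_left _ _ _ := by rw [map_add, star_add, add_mul, map_add]
  smul_left := by simp

noncomputable instance : SeminormedAddCommGroup h.PreL2 :=
  InnerProductSpace.Core.toSeminormedAddCommGroup (c := h.preL2Core)
noncomputable instance : InnerProductSpace ℂ h.PreL2 :=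
  InnerProductSpace.ofCore h.preL2Core

/-- The Hilbert space `L²(A, τ)`. -/
def L2 : Type u := UniformSpace.Completion h.PreL2

noncomputable instance : NormedAddCommGroup h.L2 :=
  inferInstanceAs (NormedAddCommGroup (UniformSpace.Completion h.PreL2))
noncomputable instance : InnerProductSpace ℂ h.L2 :=
  inferInstanceAs (InnerProductSpace ℂ (UniformSpace.Completion h.PreL2))
instance : CompleteSpace h.L2 :=
  inferInstanceAs (CompleteSpace (UniformSpace.Completion h.PreL2))

/-- The isometric embedding of the inner product space `A` into `L²(A, τ)`. -/
noncomputable def toL2 : h.PreL2 →ₗᵢ[ℂ] h.L2 :=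
  UniformSpace.Completion.toComplₗᵢ (𝕜 := ℂ) (E := h.PreL2)

/-- The canonical map from `A` to `L²(A, τ)`. -/
noncomputable def vec : A →ₗ[ℂ] h.L2 :=
  h.toL2.toLinearMap ∘ₗ h.toPreL2.toLinearMap

theorem inner_vec (a b : A) : inner ℂ (h.vec a) (h.vec b) = τ (star a * b) :=
  h.toL2.inner_map_map _ _

theorem norm_vec_sq (a : A) : ‖h.vec a‖ ^ 2 = (τ (star a * a)).re := by
  rw [← h.inner_vec, ← inner_self_eq_norm_sq (𝕜 := ℂ)]
  rfl

theorem denseRange_vec : DenseRange h.vec :=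
  UniformSpace.Completion.denseRange_coe (α := h.PreL2)

theorem norm_vec_star (a : A) : ‖h.vec (star a)‖ = ‖h.vec a‖ := by
  rw [← sq_eq_sq₀ (norm_nonneg _) (norm_nonneg _), norm_vec_sq, norm_vec_sq, star_star, h.tracial]

theorem norm_vec_one : ‖h.vec 1‖ = 1 := by
  rw [← sq_eq_sq₀ (norm_nonneg _) zero_le_one, norm_vec_sq]
  simp [h.map_one]

theorem norm_vec_mul_le {x : A} {C : ℝ} (hC : 0 ≤ C)
    (hx : ∀ a, (τ (star (x * a) * (x * a))).re ≤ C ^ 2 * (τ (star a * a)).re) (a : A) :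
    ‖h.vec (x * a)‖ ≤ C * ‖h.vec a‖ := by
  rw [← sq_le_sq₀ (norm_nonneg _) (by positivity), mul_pow, norm_vec_sq, norm_vec_sq]
  exact hx a

theorem exists_norm_vec_mul_le (x : A) : ∃ C : ℝ, ∀ a, ‖h.vec (x * a)‖ ≤ C * ‖h.vec a‖ := by
  obtain ⟨C, hC, hx⟩ := h.bounded x
  exact ⟨C, h.norm_vec_mul_le hC hx⟩

theorem norm_toPreL2 (a : A) : ‖h.toPreL2 a‖ = ‖h.vec a‖ :=
  (h.toL2.norm_map _).symm

/-- Left multiplication as a bounded operator on a dense subspace of `L²(A, τ)`. -/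
noncomputable def preRep (x : A) : h.PreL2 →L[ℂ] h.PreL2 :=
  LinearMap.mkContinuousOfExistsBound
    (h.toPreL2.toLinearMap ∘ₗ LinearMap.mulLeft ℂ x ∘ₗ h.toPreL2.symm.toLinearMap) (by
      obtain ⟨C, hC⟩ := h.exists_norm_vec_mul_le x
      refine ⟨C, fun a => ?_⟩
      have := hC (h.toPreL2.symm a)
      rw [← norm_toPreL2, ← norm_toPreL2, LinearEquiv.apply_symm_apply] at this
      exact this)

/-- Left multiplication as a bounded operator on `L²(A, τ)`. -/
noncomputable def leftMul (x : A) : h.L2 →L[ℂ] h.L2 :=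
  (h.preRep x).completion

theorem leftMul_vec (x a : A) : h.leftMul x (h.vec a) = h.vec (x * a) :=
  ContinuousLinearMap.completion_apply_coe _ _

theorem ext_vec {E : Type*} [TopologicalSpace E] [T2Space E] {f g : h.L2 → E} (hf : Continuous f)
    (hg : Continuous g) (hfg : ∀ a, f (h.vec a) = g (h.vec a)) : f = g :=
  h.denseRange_vec.equalizer hf hg (funext hfg)

theorem clm_ext {S T : h.L2 →L[ℂ] h.L2} (hST : ∀ a, S (h.vec a) = T (h.vec a)) : S = T :=
  DFunLike.coe_injective (h.ext_vec S.continuous T.continuous hST)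

/-- The representation of `A` on `L²(A, τ)` by left multiplications. -/
noncomputable def rep : A →⋆ₐ[ℂ] (h.L2 →L[ℂ] h.L2) where
  toFun := h.leftMul
  map_one' := h.clm_ext fun a => by simp [leftMul_vec]
  map_zero' := h.clm_ext fun a => by simp [leftMul_vec]
  map_mul' x y := h.clm_ext fun a => by simp [leftMul_vec, mul_assoc]
  map_add' x y := h.clm_ext fun a => by simp [leftMul_vec, add_mul]
  commutes' c := h.clm_ext fun a => by
    simp [leftMul_vec, Algebra.algebraMap_eq_smul_one]
  map_star' x := by
    rw [ContinuousLinearMap.star_eq_adjoint, ContinuousLinearMap.eq_adjoint_iff]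
    intro v w
    have h1 : ∀ b : A, (fun v => inner ℂ (h.leftMul (star x) v) (h.vec b)) =
        fun v => inner ℂ v (h.leftMul x (h.vec b)) := fun b =>
      h.ext_vec (by fun_prop) (by fun_prop) fun a => by
        simp [leftMul_vec, inner_vec, mul_assoc]
    exact congrFun (h.ext_vec (f := fun w => inner ℂ (h.leftMul (star x) v) w)
      (g := fun w => inner ℂ v (h.leftMul x w)) (by fun_prop) (by fun_prop)
      fun b => congrFun (h1 b) v) w

theorem rep_vec (x a : A) : h.rep x (h.vec a) = h.vec (x * a) := h.leftMul_vec x a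

end IsTracialState

end GNS

/-- An order-free form of `a* a ≤ ‖a‖²`, suited to applying a functional known to be nonnegative on
elements `star z * z`. -/
theorem CStarAlgebra.exists_star_mul_self_add {B : Type*} [CStarAlgebra B] (a : B) :
    ∃ z : B, star z * z + star a * a = ((‖a‖ ^ 2 : ℝ) : ℂ) • 1 := by
  let _ := CStarAlgebra.spectralOrder B
  have _ := CStarAlgebra.spectralOrderedRing B
  have h1 : star a * a ≤ algebraMap ℝ B (‖a‖ ^ 2) := CStarAlgebra.star_mul_le_algebraMap_norm_sq
  obtain ⟨z, hz⟩ := CStarAlgebra.nonneg_iff_eq_star_mul_self.1 (sub_nonneg.2 h1)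
  refine ⟨z, ?_⟩
  rw [← hz, sub_add_cancel, Algebra.algebraMap_eq_smul_one, Complex.coe_smul]

/-! ### The `L²`-norm and the weak operator topology on bounded sets. -/

namespace WStarProbabilitySpace

open Filter Topology

section Basic

variable (P : WStarProbabilitySpace.{u})

instance isClosed_toStarSubalgebra :
    IsClosed (P.M.toStarSubalgebra : Set (P.H →L[ℂ] P.H)) := by
  rw [VonNeumannAlgebra.coe_toStarSubalgebra, ← P.M.centralizer_centralizer]
  exact Set.isClosed_centralizer _

theorem exists_star_mul_self_add (a : P.Alg) :
    ∃ z : P.Alg, star z * z + star a * a = ((‖a‖ ^ 2 : ℝ) : ℂ) • 1 :=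
  CStarAlgebra.exists_star_mul_self_add a

theorem exists_one_add_sq_mul_eq_one {a : P.Alg} (ha : IsSelfAdjoint a) :
    ∃ r : P.Alg, (1 + a * a) * r = 1 := by
  refine ⟨cfc (fun t : ℝ => (1 + t * t)⁻¹) a, ?_⟩
  have hpos : ∀ t : ℝ, 1 + t * t ≠ 0 := fun t => by nlinarith [mul_self_nonneg t]
  have h1 : 1 + a * a = cfc (fun t : ℝ => 1 + t * t) a := by
    rw [cfc_add _ _ _ (by fun_prop) (by fun_prop), cfc_mul _ _ a (by fun_prop) (by fun_prop),
      cfc_id' ℝ a, cfc_const_one ℝ a]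
  rw [h1, ← cfc_mul (fun t : ℝ => 1 + t * t) (fun t : ℝ => (1 + t * t)⁻¹) a (by fun_prop)
    (Continuous.inv₀ (by fun_prop) hpos).continuousOn, ← cfc_const_one ℝ a]
  exact cfc_congr fun t _ => mul_inv_cancel₀ (hpos t)

theorem trace_star_mul_self_nonneg (a : P.Alg) : 0 ≤ P.τ (star a * a) := by
  rcases eq_or_ne a 0 with rfl | h
  · simp
  · exact (P.faithful a h).le

theorem trace_star_mul_mul_le (x a : P.Alg) :
    (P.τ (star (x * a) * (x * a))).re ≤ ‖x‖ ^ 2 * (P.τ (star a * a)).re := by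
  obtain ⟨z, hz⟩ := P.exists_star_mul_self_add x
  have h1 : star (z * a) * (z * a) + star (x * a) * (x * a) =
      ((‖x‖ ^ 2 : ℝ) : ℂ) • (star a * a) := by
    calc _ = star a * (star z * z + star x * x) * a := by
          simp only [star_mul]; noncomm_ring
      _ = _ := by rw [hz]; simp
  have h2 := congrArg (fun y => (P.τ y).re) h1
  simp only [map_add, map_smul, Complex.add_re, smul_eq_mul, Complex.re_ofReal_mul] at h2
  have h3 := (Complex.nonneg_iff.1 (P.trace_star_mul_self_nonneg (z * a))).1
  linarith

theorem isTracialState : IsTracialState P.τ where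
  nonneg := P.trace_star_mul_self_nonneg
  tracial := P.tracial
  map_one := P.map_one
  bounded x := ⟨‖x‖, norm_nonneg _, P.trace_star_mul_mul_le x⟩

/-- The canonical map from a `W*`-probability space to its `L²`-space. -/
noncomputable abbrev vec : P.Alg →ₗ[ℂ] P.isTracialState.L2 := P.isTracialState.vec

theorem norm_vec_mul_le (x a : P.Alg) : ‖P.vec (x * a)‖ ≤ ‖x‖ * ‖P.vec a‖ :=
  P.isTracialState.norm_vec_mul_le (norm_nonneg _) (P.trace_star_mul_mul_le x) a

/-- The tracial property makes the involution isometric in `L²`, which turns right multiplication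
into left multiplication. -/
theorem norm_vec_mul_le' (a x : P.Alg) : ‖P.vec (a * x)‖ ≤ ‖P.vec a‖ * ‖x‖ := by
  rw [← P.isTracialState.norm_vec_star (a * x), star_mul, ← P.isTracialState.norm_vec_star a,
    mul_comm, ← norm_star x]
  exact P.norm_vec_mul_le _ _

theorem norm_vec_le (x : P.Alg) : ‖P.vec x‖ ≤ ‖x‖ := by
  simpa [P.isTracialState.norm_vec_one] using P.norm_vec_mul_le x 1

theorem vec_injective : Function.Injective P.vec := by
  rw [injective_iff_map_eq_zero]
  intro a ha
  by_contra h
  have h1 := P.isTracialState.norm_vec_sq a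
  rw [show P.isTracialState.vec a = 0 from ha] at h1
  have h2 := (Complex.pos_iff.1 (P.faithful a h)).1
  simp at h1
  linarith

variable {P} {α : Type*} {l : Filter α}

theorem tendsto_wot_iff {f : α → P.Alg} {x : P.Alg} :
    Tendsto f l (@nhds _ P.M.wot x) ↔
      ∀ ξ η : P.H, Tendsto (fun i => inner ℂ ξ ((f i : P.H →L[ℂ] P.H) η)) l
        (𝓝 (inner ℂ ξ ((x : P.H →L[ℂ] P.H) η))) := by
  rw [nhds_induced, tendsto_comap_iff,
    ContinuousLinearMapWOT.tendsto_iff_forall_inner_apply_tendsto, forall_comm]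
  rfl

/-- The trace is continuous for bounded weak operator convergence. -/
theorem tendsto_trace {f : α → P.Alg} {x : P.Alg} {C : ℝ} (hf : ∀ᶠ i in l, ‖f i‖ ≤ C)
    (hx : ‖x‖ ≤ C) (h : Tendsto f l (@nhds _ P.M.wot x)) :
    Tendsto (fun i => P.τ (f i)) l (𝓝 (P.τ x)) := by
  -- Normality is given only on the unit ball; this nonzero factor scales the ball of radius `C`
  -- into it.
  let c : ℂ := ((|C| + 1)⁻¹ : ℝ)
  have hc : ∀ y : P.Alg, ‖y‖ ≤ C → c • y ∈ P.M.unitBall := by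
    intro y hy
    change ‖c • y‖ ≤ 1
    rw [norm_smul, Complex.norm_real, Real.norm_of_nonneg (by positivity),
      inv_mul_le_one₀ (by positivity)]
    linarith [le_abs_self C]
  have h1 : Tendsto (fun i => c • f i) l (@nhdsWithin _ P.M.wot (c • x) P.M.unitBall) := by
    refine tendsto_inf.2 ⟨?_, tendsto_principal.2 (hf.mono fun i hi => hc _ hi)⟩
    rw [tendsto_wot_iff] at h ⊢
    intro ξ η
    simpa [inner_smul_right] using (h ξ η).const_mul c
  have h2 : Tendsto (fun i => P.τ (c • f i)) l (𝓝 (P.τ (c • x))) :=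
    Tendsto.comp (P.normal (c • x) (hc x hx)) h1
  have hc0 : c ≠ 0 := by
    simp only [c, ne_eq, Complex.ofReal_eq_zero]; positivity
  simpa [hc0] using h2.const_mul c⁻¹

theorem tendsto_wot_mul_right {f : α → P.Alg} {x : P.Alg} (h : Tendsto f l (@nhds _ P.M.wot x))
    (c : P.Alg) : Tendsto (fun i => f i * c) l (@nhds _ P.M.wot (x * c)) := by
  rw [tendsto_wot_iff] at h ⊢
  exact fun ξ η => h ξ ((c : P.H →L[ℂ] P.H) η)

theorem tendsto_trace_mul {f : α → P.Alg} {x : P.Alg} {C : ℝ} (hf : ∀ᶠ i in l, ‖f i‖ ≤ C)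
    (hx : ‖x‖ ≤ C) (h : Tendsto f l (@nhds _ P.M.wot x)) (c : P.Alg) :
    Tendsto (fun i => P.τ (f i * c)) l (𝓝 (P.τ (x * c))) := by
  refine tendsto_trace (C := C * ‖c‖) (hf.mono fun i hi => ?_) ?_ (tendsto_wot_mul_right h c)
  · exact (norm_mul_le _ _).trans (mul_le_mul_of_nonneg_right hi (norm_nonneg _))
  · exact (norm_mul_le _ _).trans (mul_le_mul_of_nonneg_right hx (norm_nonneg _))

/-- Closed balls of a von Neumann algebra are compact in the weak operator topology. -/
theorem exists_tendsto_wot (U : Ultrafilter α) {f : α → P.Alg} {C : ℝ}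
    (hf : ∀ᶠ i in U, ‖f i‖ ≤ C) :
    ∃ x : P.Alg, ‖x‖ ≤ C ∧ Tendsto f U (@nhds _ P.M.wot x) := by
  obtain ⟨T, hT, hlim⟩ := U.exists_weakOperator_limit (fun i => (f i : P.H →L[ℂ] P.H)) C hf
  have hTM : T ∈ P.M :=
    P.M.mem_of_weakOperator_limit (Eventually.of_forall fun i => (f i).2) hlim
  exact ⟨⟨T, hTM⟩, hT, tendsto_wot_iff.2 hlim⟩

theorem eq_of_trace_mul_eq {x y : P.Alg} (h : ∀ c, P.τ (x * c) = P.τ (y * c)) : x = y := by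
  apply star_injective
  rw [← sub_eq_zero]
  by_contra hne
  have h1 := P.faithful _ hne
  rw [star_sub, star_star, star_star, sub_mul, map_sub, h, sub_self] at h1
  exact lt_irrefl _ h1

/-- On bounded sets, the weak operator topology is determined by the trace. -/
theorem tendsto_wot_of_tendsto_trace_mul {f : α → P.Alg} {x : P.Alg} {C : ℝ}
    (hf : ∀ᶠ i in l, ‖f i‖ ≤ C)
    (h : ∀ c, Tendsto (fun i => P.τ (f i * c)) l (𝓝 (P.τ (x * c)))) :
    Tendsto f l (@nhds _ P.M.wot x) := by
  rw [tendsto_iff_ultrafilter]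
  intro U hU
  -- Compactness supplies a limit along each ultrafilter, and the traces against all `c` identify it
  -- as `x`.
  obtain ⟨z, hz, hlim⟩ := exists_tendsto_wot U (hf.filter_mono hU)
  have : z = x := eq_of_trace_mul_eq fun c =>
    tendsto_nhds_unique (tendsto_trace_mul (hf.filter_mono hU) hz hlim c) ((h c).mono_left hU)
  exact this ▸ hlim

/-- Balls of a `W*`-probability space are closed in its `L²`-space. -/
theorem exists_vec_eq_of_tendsto [l.NeBot] {f : α → P.Alg} {C : ℝ} (hf : ∀ᶠ i in l, ‖f i‖ ≤ C)
    {v : P.isTracialState.L2} (hv : Tendsto (fun i => P.vec (f i)) l (𝓝 v)) :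
    ∃ x : P.Alg, ‖x‖ ≤ C ∧ P.vec x = v := by
  let U := Ultrafilter.of l
  have hU : ↑U ≤ l := Ultrafilter.of_le l
  obtain ⟨x, hx, hlim⟩ := exists_tendsto_wot U (hf.filter_mono hU)
  refine ⟨x, hx, ?_⟩
  have h1 : ∀ c, inner ℂ (P.vec c) (P.vec x) = inner ℂ (P.vec c) v := fun c => by
    refine tendsto_nhds_unique ?_ ((tendsto_const_nhds (x := P.vec c)).inner (hv.mono_left hU))
    simp only [P.isTracialState.inner_vec, P.tracial (star c)]
    exact tendsto_trace_mul (hf.filter_mono hU) hx hlim (star c)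
  refine ext_inner_left ℂ fun w => ?_
  exact congrFun (P.isTracialState.ext_vec (f := fun w => inner ℂ w (P.vec x))
    (g := fun w => inner ℂ w v) (by fun_prop) (by fun_prop) h1) w

theorem tendsto_wot_of_tendsto_vec {f : α → P.Alg} {x : P.Alg} {C : ℝ}
    (hf : ∀ᶠ i in l, ‖f i‖ ≤ C) (h : Tendsto (fun i => P.vec (f i)) l (𝓝 (P.vec x))) :
    Tendsto f l (@nhds _ P.M.wot x) := by
  refine tendsto_wot_of_tendsto_trace_mul hf fun c => ?_
  have := (tendsto_const_nhds (x := P.vec (star c))).inner h (𝕜 := ℂ)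
  simpa only [P.isTracialState.inner_vec, star_star, P.tracial c] using this

end Basic

end WStarProbabilitySpace

/-! ### The von Neumann algebra generated by a `*`-algebra. -/

/-- The von Neumann algebra generated by a unital `*`-algebra of operators. -/
noncomputable def StarSubalgebra.bicommutant {H : Type*} [NormedAddCommGroup H]
    [InnerProductSpace ℂ H] [CompleteSpace H] (A : StarSubalgebra ℂ (H →L[ℂ] H)) :
    VonNeumannAlgebra H where
  toStarSubalgebra := StarSubalgebra.centralizer ℂ
    (StarSubalgebra.centralizer ℂ (A : Set (H →L[ℂ] H)) : Set (H →L[ℂ] H))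
  centralizer_centralizer' := by
    change Set.centralizer (Set.centralizer (StarSubalgebra.centralizer ℂ
      (StarSubalgebra.centralizer ℂ (A : Set (H →L[ℂ] H)) : Set (H →L[ℂ] H)) :
        Set (H →L[ℂ] H))) = (StarSubalgebra.centralizer ℂ
      (StarSubalgebra.centralizer ℂ (A : Set (H →L[ℂ] H)) : Set (H →L[ℂ] H)) :
        Set (H →L[ℂ] H))
    rw [StarSubalgebra.coe_centralizer]
    simp

namespace StarSubalgebra

variable {H : Type*} [NormedAddCommGroup H] [InnerProductSpace ℂ H] [CompleteSpace H]

theorem coe_bicommutant (A : StarSubalgebra ℂ (H →L[ℂ] H)) :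
    (A.bicommutant : Set (H →L[ℂ] H)) =
      Set.centralizer (Set.centralizer (A : Set (H →L[ℂ] H))) := by
  change (StarSubalgebra.centralizer ℂ
      (StarSubalgebra.centralizer ℂ (A : Set (H →L[ℂ] H)) : Set (H →L[ℂ] H)) :
        Set (H →L[ℂ] H)) = _
  rw [StarSubalgebra.coe_centralizer, StarSubalgebra.coe_centralizer]
  have : star (A : Set (H →L[ℂ] H)) = A := by
    ext x; exact star_mem_iff (s := A)
  rw [this, Set.union_self, Set.star_centralizer, this, Set.union_self]

theorem subset_bicommutant (A : StarSubalgebra ℂ (H →L[ℂ] H)) :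
    (A : Set (H →L[ℂ] H)) ⊆ A.bicommutant := by
  rw [coe_bicommutant]
  exact Set.subset_centralizer_centralizer

theorem bicommutant_le (A : StarSubalgebra ℂ (H →L[ℂ] H)) {N : VonNeumannAlgebra H}
    (h : (A : Set (H →L[ℂ] H)) ⊆ N) : A.bicommutant ≤ N := by
  rw [← SetLike.coe_subset_coe, coe_bicommutant, ← N.centralizer_centralizer]
  exact Set.centralizer_subset (Set.centralizer_subset h)

end StarSubalgebra

namespace WStarProbabilitySpace

open Filter Topology

/-! ### Automatic normality of trace preserving homomorphisms. -/

section Hom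

variable {P : WStarProbabilitySpace.{u}} {Q : WStarProbabilitySpace.{v}}
  {φ : P.Alg →⋆ₐ[ℂ] Q.Alg}

theorem norm_vec_map (hφ : ∀ a, Q.τ (φ a) = P.τ a) (a : P.Alg) :
    ‖Q.vec (φ a)‖ = ‖P.vec a‖ := by
  rw [← sq_eq_sq₀ (norm_nonneg _) (norm_nonneg _), Q.isTracialState.norm_vec_sq,
    P.isTracialState.norm_vec_sq, ← map_star, ← map_mul, hφ]

theorem injective_of_trace_comp (hφ : ∀ a, Q.τ (φ a) = P.τ a) : Function.Injective φ := by
  rw [injective_iff_map_eq_zero]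
  intro a ha
  have := norm_vec_map hφ a
  rw [ha, map_zero, norm_zero] at this
  exact P.vec_injective (by rw [norm_eq_zero.1 this.symm, map_zero])

theorem norm_map_of_trace_comp (hφ : ∀ a, Q.τ (φ a) = P.τ a) (a : P.Alg) : ‖φ a‖ = ‖a‖ :=
  NonUnitalStarAlgHom.norm_map φ (injective_of_trace_comp hφ) a

/-- In `L²(Q)`, `c` may be replaced by its projection onto the closure of the range of `φ`. That
projection is approximated by some `φ b`, uniformly for `a` in the unit ball, and `Q.τ (φ a * φ b) =
P.τ (a * b)`. -/
theorem tendsto_trace_map_mul (hφ : ∀ a, Q.τ (φ a) = P.τ a) {l : Filter P.Alg} {x : P.Alg}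
    (hx : ‖x‖ ≤ 1) (hl : ∀ᶠ a in l, ‖a‖ ≤ 1)
    (hlx : ∀ b, Tendsto (fun a => P.τ (a * b)) l (𝓝 (P.τ (x * b)))) (c : Q.Alg) :
    Tendsto (fun a => Q.τ (φ a * c)) l (𝓝 (Q.τ (φ x * c))) := by
  let K : Submodule ℂ Q.isTracialState.L2 :=
    (LinearMap.range (Q.vec ∘ₗ (φ : P.Alg →ₗ[ℂ] Q.Alg))).topologicalClosure
  have hKcl : IsClosed (K : Set Q.isTracialState.L2) := Submodule.isClosed_topologicalClosure _
  have : CompleteSpace K := hKcl.completeSpace_coe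
  obtain ⟨ζ, h2, h1⟩ : ∃ ζ ∈ K, ∀ a, Q.τ (φ a * c) = inner ℂ (Q.vec (φ (star a))) ζ := by
    refine ⟨K.starProjection (Q.vec c), Submodule.starProjection_apply_mem _ _, fun a => ?_⟩
    have hmem : Q.vec (φ (star a)) ∈ K := subset_closure ⟨star a, rfl⟩
    rw [← Submodule.inner_starProjection_left_eq_right,
      Submodule.starProjection_eq_self_iff.2 hmem, Q.isTracialState.inner_vec, map_star, star_star]
  rw [Metric.tendsto_nhds]
  intro ε hε
  obtain ⟨_, ⟨b, rfl⟩, hb⟩ := Metric.mem_closure_iff.1 h2 (ε / 3) (by positivity)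
  have h3 : ∀ a, ‖a‖ ≤ 1 → dist (Q.τ (φ a * c)) (P.τ (a * b)) < ε / 3 := by
    intro a ha
    have e1 : P.τ (a * b) = inner ℂ (Q.vec (φ (star a))) (Q.vec (φ b)) := by
      rw [Q.isTracialState.inner_vec, map_star, star_star, ← map_mul, hφ]
    rw [e1, h1, dist_eq_norm, ← inner_sub_right]
    refine (norm_inner_le_norm _ _).trans_lt ?_
    rw [norm_vec_map hφ, P.isTracialState.norm_vec_star, ← dist_eq_norm]
    exact (mul_le_of_le_one_left dist_nonneg ((P.norm_vec_le a).trans ha)).trans_lt hb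
  filter_upwards [hl, (Metric.tendsto_nhds.1 (hlx b)) (ε / 3) (by positivity)] with a ha hab
  have h5 := h3 a ha
  have h6 := h3 x hx
  have h7 := dist_triangle4 (Q.τ (φ a * c)) (P.τ (a * b)) (P.τ (x * b)) (Q.τ (φ x * c))
  rw [dist_comm (P.τ (x * b))] at h7
  linarith

/-- Trace preserving `*`-homomorphisms are normal. -/
theorem isNormal_of_trace_comp (hφ : ∀ a, Q.τ (φ a) = P.τ a) : IsNormal φ := by
  intro x hx
  have hl : ∀ᶠ a in @nhdsWithin _ P.M.wot x P.M.unitBall, ‖a‖ ≤ 1 :=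
    @self_mem_nhdsWithin _ P.M.wot x P.M.unitBall
  have hlx : Tendsto id (@nhdsWithin _ P.M.wot x P.M.unitBall) (@nhds _ P.M.wot x) := inf_le_left
  refine tendsto_wot_of_tendsto_trace_mul (C := 1)
    (hl.mono fun a ha => (norm_map_of_trace_comp hφ a).trans_le ha) fun c => ?_
  exact tendsto_trace_map_mul hφ hx hl (fun b => tendsto_trace_mul hl hx hlx b) c

end Hom

/-! ### Generation as bounded `L²`-density. -/

section Generation

variable {P : WStarProbabilitySpace.{u}}

/-- The squared `L²`-distance is the trace of `star (f i - x) * (f i - x)`, which is bounded and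
tends weakly to `0`; normality of the trace finishes. -/
theorem tendsto_vec_of_tendsto_apply {α : Type*} {l : Filter α} {f : α → P.Alg} {x : P.Alg} {C : ℝ}
    (hf : ∀ᶠ i in l, ‖f i‖ ≤ C)
    (h : ∀ ξ, Tendsto (fun i => (f i : P.H →L[ℂ] P.H) ξ) l (𝓝 ((x : P.H →L[ℂ] P.H) ξ))) :
    Tendsto (fun i => P.vec (f i)) l (𝓝 (P.vec x)) := by
  rw [tendsto_iff_norm_sub_tendsto_zero]
  have h1 : Tendsto (fun i => star (f i - x) * (f i - x)) l (@nhds _ P.M.wot 0) := by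
    rw [tendsto_wot_iff]
    intro ξ η
    have h2 : ∀ ξ, Tendsto (fun i => ((f i - x : P.Alg) : P.H →L[ℂ] P.H) ξ) l (𝓝 0) := fun ξ => by
      have := (h ξ).sub_const ((x : P.H →L[ℂ] P.H) ξ)
      simpa using this
    have h3 := (h2 ξ).inner (h2 η) (𝕜 := ℂ)
    rw [inner_zero_left] at h3
    have h4 : inner ℂ ξ (((0 : P.Alg) : P.H →L[ℂ] P.H) η) = 0 := by simp
    rw [h4]
    refine h3.congr fun i => ?_
    exact (ContinuousLinearMap.adjoint_inner_right ((f i - x : P.Alg) : P.H →L[ℂ] P.H) _ _).symm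
  have h5 := tendsto_trace (C := (C + ‖x‖) ^ 2) (hf.mono fun i hi => ?_) (by simp; positivity) h1
  · have h6 := (Complex.continuous_re.tendsto _).comp h5
    have h7 := (Real.continuous_sqrt.tendsto _).comp h6
    simp only [map_zero, Complex.zero_re, Real.sqrt_zero] at h7
    refine h7.congr fun i => ?_
    simp only [Function.comp_apply]
    rw [← P.isTracialState.norm_vec_sq, Real.sqrt_sq (norm_nonneg _), map_sub]
  · rw [CStarRing.norm_star_mul_self, ← sq]
    exact pow_le_pow_left₀ (norm_nonneg _) ((norm_sub_le _ _).trans (by gcongr)) 2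

theorem mem_closure_vec_of_isSelfAdjoint {X : Set (P.H →L[ℂ] P.H)} (hX : P.M.IsGeneratedBy X)
    (A : StarSubalgebra ℂ P.Alg) (hXA : X ⊆ (fun a : P.Alg => (a : P.H →L[ℂ] P.H)) '' A)
    (hA : ∀ a ∈ A, IsSelfAdjoint a → ∃ r ∈ A, (1 + a * a) * r = 1)
    {x : P.Alg} (hx : IsSelfAdjoint x) (hx1 : ‖x‖ ≤ 1) :
    P.vec x ∈ closure (P.vec '' {a | a ∈ A ∧ ‖a‖ ≤ 1}) := by
  let B : StarSubalgebra ℂ (P.H →L[ℂ] P.H) := A.map P.M.toStarSubalgebra.subtype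
  have hB : ∀ y, y ∈ B ↔ ∃ a ∈ A, (a : P.H →L[ℂ] P.H) = y := fun y => Iff.rfl
  have hxB : (x : P.H →L[ℂ] P.H) ∈ B.bicommutant := hX.2 (fun y hy => by
    obtain ⟨a, ha, rfl⟩ := hXA hy
    exact B.subset_bicommutant ⟨a, ha, rfl⟩) x.2
  rw [← SetLike.mem_coe, B.coe_bicommutant] at hxB
  have key := B.isStrongLimit_unitBall (T := x) (fun y hy hysa => by
    obtain ⟨a, ha, rfl⟩ := (hB y).1 hy
    obtain ⟨r, hr, hr'⟩ := hA a ha (Subtype.ext hysa)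
    exact ⟨r, ⟨r, hr, rfl⟩, congrArg Subtype.val hr'⟩) (congrArg Subtype.val hx) hx1 hxB
  obtain ⟨l, hl, hs, hlim⟩ := key
  -- The approximating filter lives on all operators but is concentrated on elements of `A`, so its
  -- pullback to the algebra is proper.
  let l' : Filter P.Alg := comap (fun a : P.Alg => (a : P.H →L[ℂ] P.H)) l
  have hl' : l'.NeBot := by
    refine comap_neBot_iff.2 fun t ht => ?_
    obtain ⟨y, hyt, hyB, -⟩ := hl.nonempty_of_mem (inter_mem ht hs)
    obtain ⟨a, -, rfl⟩ := (hB y).1 hyB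
    exact ⟨a, hyt⟩
  have hs' : ∀ᶠ a in l', a ∈ A ∧ ‖a‖ ≤ 1 := by
    filter_upwards [preimage_mem_comap hs] with a ha
    obtain ⟨b, hb, hba⟩ := (hB _).1 ha.1
    exact ⟨Subtype.ext hba ▸ hb, ha.2⟩
  have h1 := tendsto_vec_of_tendsto_apply (P := P) (l := l') (f := id) (x := x) (C := 1)
    (hs'.mono fun a ha => ha.2) fun ξ => (hlim ξ).comp tendsto_comap
  exact mem_closure_of_tendsto h1 (hs'.mono fun a ha => ⟨a, ha, rfl⟩)

/-- If a von Neumann algebra is generated by a `*`-algebra containing the resolvents of its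
self-adjoint elements, then each of its elements is a bounded limit, in the `L²`-norm, of elements
of this `*`-algebra. -/
theorem exists_mem_closure_vec {X : Set (P.H →L[ℂ] P.H)} (hX : P.M.IsGeneratedBy X)
    (A : StarSubalgebra ℂ P.Alg) (hXA : X ⊆ (fun a : P.Alg => (a : P.H →L[ℂ] P.H)) '' A)
    (hA : ∀ a ∈ A, IsSelfAdjoint a → ∃ r ∈ A, (1 + a * a) * r = 1) (x : P.Alg) :
    ∃ C : ℝ, P.vec x ∈ closure (P.vec '' {a | a ∈ A ∧ ‖a‖ ≤ C}) := by
  have hsa : ∀ y : P.Alg, IsSelfAdjoint y →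
      ∃ C : ℝ, P.vec y ∈ closure (P.vec '' {a | a ∈ A ∧ ‖a‖ ≤ C}) := by
    intro y hy
    let c : ℝ := ‖y‖ + 1
    have hc : 0 < c := by positivity
    have h1 := mem_closure_vec_of_isSelfAdjoint hX A hXA hA (x := ((c⁻¹ : ℝ) : ℂ) • y)
      (by rw [isSelfAdjoint_iff, star_smul, hy.star_eq]; simp)
      (by
        rw [norm_smul, Complex.norm_real, Real.norm_of_nonneg (by positivity),
          inv_mul_le_one₀ hc]
        simp [c])
    refine ⟨c, ?_⟩
    have h2 : P.vec y = (c : ℂ) • P.vec (((c⁻¹ : ℝ) : ℂ) • y) := by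
      rw [← map_smul, smul_smul, ← Complex.ofReal_mul, mul_inv_cancel₀ hc.ne']; simp
    rw [h2]
    refine map_mem_closure (continuous_const_smul _) h1 ?_
    rintro _ ⟨a, ⟨ha, ha'⟩, rfl⟩
    refine ⟨(c : ℂ) • a, ⟨A.smul_mem ha _, ?_⟩, map_smul _ _ _⟩
    rw [norm_smul, Complex.norm_real, Real.norm_of_nonneg hc.le]
    exact mul_le_of_le_one_right hc.le ha'
  obtain ⟨C, hC⟩ := hsa (realPart x) (realPart x).2
  obtain ⟨D, hD⟩ := hsa (imaginaryPart x) (imaginaryPart x).2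
  refine ⟨C + D, ?_⟩
  rw [← realPart_add_I_smul_imaginaryPart x, map_add, map_smul]
  have hcont : Continuous (Function.uncurry fun v w : P.isTracialState.L2 => v + Complex.I • w) :=
    continuous_fst.add ((continuous_const_smul Complex.I).comp continuous_snd)
  refine map_mem_closure₂ (f := fun v w => v + Complex.I • w) hcont hC hD ?_
  rintro _ ⟨a, ⟨ha, ha'⟩, rfl⟩ _ ⟨b, ⟨hb, hb'⟩, rfl⟩
  refine ⟨a + Complex.I • b, ⟨add_mem ha (A.smul_mem hb _), ?_⟩,
    (map_add _ _ _).trans (congrArg _ (map_smul _ _ _))⟩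
  refine (norm_add_le _ _).trans (add_le_add ha' ?_)
  rw [norm_smul]
  simpa using hb'

/-- A converse of `exists_mem_closure_vec`. -/
theorem isGeneratedBy_of_mem_closure_vec {X : Set (P.H →L[ℂ] P.H)} (hX : X ⊆ P.M)
    (A : Set P.Alg) (hXA : ∀ N : VonNeumannAlgebra P.H, X ⊆ N → ∀ a ∈ A, (a : P.H →L[ℂ] P.H) ∈ N)
    (hA : ∀ x : P.Alg, ∃ C : ℝ, P.vec x ∈ closure (P.vec '' {a | a ∈ A ∧ ‖a‖ ≤ C})) :
    P.M.IsGeneratedBy X := by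
  refine ⟨hX, fun N hN x hx => ?_⟩
  obtain ⟨C, hC⟩ := hA ⟨x, hx⟩
  obtain ⟨v, hv, hlim⟩ := mem_closure_iff_seq_limit.1 hC
  choose a ha hav using hv
  have h1 : Tendsto a atTop (@nhds _ P.M.wot ⟨x, hx⟩) :=
    tendsto_wot_of_tendsto_vec (C := C) (Eventually.of_forall fun i => (ha i).2)
      (by simpa only [hav] using hlim)
  exact N.mem_of_weakOperator_limit (l := atTop) (Eventually.of_forall fun i => hXA N hN _ (ha i).1)
    (tendsto_wot_iff.1 h1)

end Generation

end WStarProbabilitySpace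

/-! ### Extension of a correspondence by bounded `L²`-limits. -/

namespace WStarProbabilitySpace

open Filter Topology

section CommonLimit

variable {P : WStarProbabilitySpace.{u}} {Q : WStarProbabilitySpace.{v}} {α : Type*} {l : Filter α}

/-- Splits `f g - x y = f (g - y) + (f - x) y`; only the left factor has to be bounded. -/
theorem tendsto_vec_mul {f g : α → P.Alg} {x y : P.Alg} {C : ℝ} (hf : ∀ᶠ i in l, ‖f i‖ ≤ C)
    (hfx : Tendsto (fun i => P.vec (f i)) l (𝓝 (P.vec x)))
    (hgy : Tendsto (fun i => P.vec (g i)) l (𝓝 (P.vec y))) :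
    Tendsto (fun i => P.vec (f i * g i)) l (𝓝 (P.vec (x * y))) := by
  rw [tendsto_iff_norm_sub_tendsto_zero] at hfx hgy ⊢
  have h := (hgy.const_mul C).add (hfx.mul_const ‖y‖)
  rw [mul_zero, zero_mul, add_zero] at h
  refine squeeze_zero' (Eventually.of_forall fun _ => norm_nonneg _) ?_ h
  filter_upwards [hf] with i hi
  have h1 : P.vec (f i * g i) - P.vec (x * y) =
      P.vec (f i * (g i - y)) + P.vec ((f i - x) * y) := by
    rw [← map_sub, ← map_add]; congr 1; noncomm_ring
  rw [h1, ← map_sub, ← map_sub]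
  refine (norm_add_le _ _).trans (add_le_add ?_ (P.norm_vec_mul_le' _ _))
  exact (P.norm_vec_mul_le _ _).trans (mul_le_mul_of_nonneg_right hi (norm_nonneg _))

theorem tendsto_vec_star {f : α → P.Alg} {x : P.Alg}
    (hfx : Tendsto (fun i => P.vec (f i)) l (𝓝 (P.vec x))) :
    Tendsto (fun i => P.vec (star (f i))) l (𝓝 (P.vec (star x))) := by
  rw [tendsto_iff_norm_sub_tendsto_zero] at hfx ⊢
  refine hfx.congr fun i => ?_
  rw [← map_sub, ← map_sub, ← star_sub, P.isTracialState.norm_vec_star]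

/-- `x` and `y` are the bounded `L²`-limits of the two components of a net in `D`. -/
def IsCommonLimit (D : StarSubalgebra ℂ (P.Alg × Q.Alg)) (x : P.Alg) (y : Q.Alg) : Prop :=
  ∃ (C : ℝ) (l : Filter (P.Alg × Q.Alg)), l.NeBot ∧
    (∀ᶠ p in l, p ∈ D) ∧ (∀ᶠ p in l, ‖p.1‖ ≤ C) ∧ (∀ᶠ p in l, ‖p.2‖ ≤ C) ∧
    Tendsto (fun p => P.vec p.1) l (𝓝 (P.vec x)) ∧ Tendsto (fun p => Q.vec p.2) l (𝓝 (Q.vec y))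

variable {D : StarSubalgebra ℂ (P.Alg × Q.Alg)}

theorem IsCommonLimit.of_mem {p : P.Alg × Q.Alg} (hp : p ∈ D) : IsCommonLimit D p.1 p.2 := by
  refine ⟨max ‖p.1‖ ‖p.2‖, pure p, inferInstance, ?_, ?_, ?_, ?_, ?_⟩
  · simpa using hp
  · simp
  · simp
  · exact tendsto_pure_nhds (fun p : P.Alg × Q.Alg => P.vec p.1) p
  · exact tendsto_pure_nhds (fun p : P.Alg × Q.Alg => Q.vec p.2) p

theorem IsCommonLimit.add {x x' : P.Alg} {y y' : Q.Alg} (h : IsCommonLimit D x y)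
    (h' : IsCommonLimit D x' y') : IsCommonLimit D (x + x') (y + y') := by
  obtain ⟨C, l, hl, hD, h1, h2, hx, hy⟩ := h
  obtain ⟨C', l', hl', hD', h1', h2', hx', hy'⟩ := h'
  refine ⟨C + C', map (fun q => q.1 + q.2) (l ×ˢ l'), inferInstance, ?_, ?_, ?_, ?_, ?_⟩
  · rw [eventually_map]
    filter_upwards [hD.prod_mk hD'] with q hq using add_mem hq.1 hq.2
  · rw [eventually_map]
    filter_upwards [h1.prod_mk h1'] with q hq
      using (norm_add_le _ _).trans (add_le_add hq.1 hq.2)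
  · rw [eventually_map]
    filter_upwards [h2.prod_mk h2'] with q hq
      using (norm_add_le _ _).trans (add_le_add hq.1 hq.2)
  · rw [tendsto_map'_iff, map_add]
    exact ((hx.comp tendsto_fst).add (hx'.comp tendsto_snd)).congr fun q => (map_add _ _ _).symm
  · rw [tendsto_map'_iff, map_add]
    exact ((hy.comp tendsto_fst).add (hy'.comp tendsto_snd)).congr fun q => (map_add _ _ _).symm

theorem IsCommonLimit.mul {x x' : P.Alg} {y y' : Q.Alg} (h : IsCommonLimit D x y)
    (h' : IsCommonLimit D x' y') : IsCommonLimit D (x * x') (y * y') := by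
  obtain ⟨C, l, hl, hD, h1, h2, hx, hy⟩ := h
  obtain ⟨C', l', hl', hD', h1', h2', hx', hy'⟩ := h'
  refine ⟨|C| * C', map (fun q => q.1 * q.2) (l ×ˢ l'), inferInstance, ?_, ?_, ?_, ?_, ?_⟩
  · rw [eventually_map]
    filter_upwards [hD.prod_mk hD'] with q hq using mul_mem hq.1 hq.2
  · rw [eventually_map]
    filter_upwards [h1.prod_mk h1'] with q hq
    exact (norm_mul_le _ _).trans
      (mul_le_mul (hq.1.trans (le_abs_self C)) hq.2 (norm_nonneg _) (abs_nonneg _))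
  · rw [eventually_map]
    filter_upwards [h2.prod_mk h2'] with q hq
    exact (norm_mul_le _ _).trans
      (mul_le_mul (hq.1.trans (le_abs_self C)) hq.2 (norm_nonneg _) (abs_nonneg _))
  · rw [tendsto_map'_iff]
    exact tendsto_vec_mul (h1.prod_inl l') (hx.comp tendsto_fst) (hx'.comp tendsto_snd)
  · rw [tendsto_map'_iff]
    exact tendsto_vec_mul (h2.prod_inl l') (hy.comp tendsto_fst) (hy'.comp tendsto_snd)

theorem IsCommonLimit.star {x : P.Alg} {y : Q.Alg} (h : IsCommonLimit D x y) :
    IsCommonLimit D (star x) (star y) := by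
  obtain ⟨C, l, hl, hD, h1, h2, hx, hy⟩ := h
  refine ⟨C, map Star.star l, inferInstance, ?_, ?_, ?_, ?_, ?_⟩
  · rw [eventually_map]
    exact hD.mono fun q hq => star_mem hq
  · rw [eventually_map]
    exact h1.mono fun q hq => (norm_star q.1).trans_le hq
  · rw [eventually_map]
    exact h2.mono fun q hq => (norm_star q.2).trans_le hq
  · rw [tendsto_map'_iff]
    exact tendsto_vec_star hx
  · rw [tendsto_map'_iff]
    exact tendsto_vec_star hy

theorem IsCommonLimit.smul {x : P.Alg} {y : Q.Alg} (c : ℂ) (h : IsCommonLimit D x y) :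
    IsCommonLimit D (c • x) (c • y) := by
  have h1 : IsCommonLimit D (algebraMap ℂ P.Alg c) (algebraMap ℂ Q.Alg c) :=
    IsCommonLimit.of_mem (D.algebraMap_mem c)
  rw [Algebra.smul_def, Algebra.smul_def]
  exact h1.mul h

theorem IsCommonLimit.trace_eq (hD : ∀ p ∈ D, P.τ p.1 = Q.τ p.2) {x : P.Alg} {y : Q.Alg}
    (h : IsCommonLimit D x y) : P.τ x = Q.τ y := by
  obtain ⟨C, l, hl, hlD, h1, h2, hx, hy⟩ := h
  have hx' := (tendsto_const_nhds (x := P.vec 1)).inner hx (𝕜 := ℂ)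
  have hy' := (tendsto_const_nhds (x := Q.vec 1)).inner hy (𝕜 := ℂ)
  simp only [IsTracialState.inner_vec, star_one, one_mul] at hx' hy'
  exact tendsto_nhds_unique hx' (hy'.congr' (hlD.mono fun p hp => (hD p hp).symm))

theorem IsCommonLimit.norm_vec_eq (hD : ∀ p ∈ D, P.τ p.1 = Q.τ p.2) {x : P.Alg} {y : Q.Alg}
    (h : IsCommonLimit D x y) : ‖P.vec x‖ = ‖Q.vec y‖ := by
  rw [← sq_eq_sq₀ (norm_nonneg _) (norm_nonneg _), P.isTracialState.norm_vec_sq,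
    Q.isTracialState.norm_vec_sq, (h.star.mul h).trace_eq hD]

/-- The difference of two common limits is one again, so its components have equal `L²`-norm. Thus
the relation is the graph of an injective partial function. -/
theorem IsCommonLimit.eq_iff (hD : ∀ p ∈ D, P.τ p.1 = Q.τ p.2) {x x' : P.Alg} {y y' : Q.Alg}
    (h : IsCommonLimit D x y) (h' : IsCommonLimit D x' y') : x = x' ↔ y = y' := by
  have h1 := (h.add (h'.smul (-1))).norm_vec_eq hD
  simp only [neg_smul, one_smul, ← sub_eq_add_neg] at h1
  rw [← sub_eq_zero, ← map_eq_zero_iff _ P.vec_injective, ← norm_eq_zero, h1, norm_eq_zero,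
    map_eq_zero_iff _ Q.vec_injective, sub_eq_zero]

theorem norm_vec_eq_of_mem (hD : ∀ p ∈ D, P.τ p.1 = Q.τ p.2) {p : P.Alg × Q.Alg} (hp : p ∈ D) :
    ‖P.vec p.1‖ = ‖Q.vec p.2‖ := (IsCommonLimit.of_mem hp).norm_vec_eq hD

/-- The partners of an approximating sequence are `L²`-Cauchy because traces agree on `D`, and
bounded because norms do. Closedness of balls in `L²` then provides the limit `y`. -/
theorem exists_isCommonLimit_left (hD : ∀ p ∈ D, P.τ p.1 = Q.τ p.2)
    (hn : ∀ p ∈ D, ‖p.1‖ = ‖p.2‖) {x : P.Alg} {C : ℝ}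
    (hx : P.vec x ∈ closure (P.vec '' {a | (∃ b, (a, b) ∈ D) ∧ ‖a‖ ≤ C})) :
    ∃ y, IsCommonLimit D x y := by
  obtain ⟨v, hv, hlim⟩ := mem_closure_iff_seq_limit.1 hx
  choose a ha hav using hv
  choose b hb using fun n => (ha n).1
  have hbC : ∀ n, ‖b n‖ ≤ C := fun n => (hn _ (hb n)).symm.trans_le (ha n).2
  have hcauchy : CauchySeq fun n => Q.vec (b n) := by
    have h1 := hlim.cauchySeq
    rw [Metric.cauchySeq_iff'] at h1 ⊢
    intro ε hε
    obtain ⟨N, hN⟩ := h1 ε hε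
    refine ⟨N, fun n hnN => ?_⟩
    have h2 := norm_vec_eq_of_mem hD (sub_mem (hb n) (hb N))
    have h3 := hN n hnN
    rw [← hav, ← hav, dist_eq_norm, ← map_sub] at h3
    rw [dist_eq_norm, ← map_sub]
    exact h2.symm.trans_lt h3
  obtain ⟨w, hw⟩ := cauchySeq_tendsto_of_complete hcauchy
  obtain ⟨y, -, rfl⟩ := exists_vec_eq_of_tendsto (Eventually.of_forall hbC) hw
  refine ⟨y, C, map (fun n => (a n, b n)) atTop, inferInstance, ?_, ?_, ?_, ?_, hw⟩
  · exact eventually_map.2 <| Eventually.of_forall hb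
  · exact eventually_map.2 <| Eventually.of_forall fun n => (ha n).2
  · exact eventually_map.2 <| Eventually.of_forall hbC
  · rw [tendsto_map'_iff]
    exact hlim.congr fun n => (hav n).symm

theorem exists_isCommonLimit_right (hD : ∀ p ∈ D, P.τ p.1 = Q.τ p.2)
    (hn : ∀ p ∈ D, ‖p.1‖ = ‖p.2‖) {y : Q.Alg} {C : ℝ}
    (hy : Q.vec y ∈ closure (Q.vec '' {b | (∃ a, (a, b) ∈ D) ∧ ‖b‖ ≤ C})) :
    ∃ x, IsCommonLimit D x y := by
  obtain ⟨v, hv, hlim⟩ := mem_closure_iff_seq_limit.1 hy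
  choose b hb hbv using hv
  choose a ha using fun n => (hb n).1
  have haC : ∀ n, ‖a n‖ ≤ C := fun n => (hn _ (ha n)).trans_le (hb n).2
  have hcauchy : CauchySeq fun n => P.vec (a n) := by
    have h1 := hlim.cauchySeq
    rw [Metric.cauchySeq_iff'] at h1 ⊢
    intro ε hε
    obtain ⟨N, hN⟩ := h1 ε hε
    refine ⟨N, fun n hnN => ?_⟩
    have h2 := norm_vec_eq_of_mem hD (sub_mem (ha n) (ha N))
    have h3 := hN n hnN
    rw [← hbv, ← hbv, dist_eq_norm, ← map_sub] at h3
    rw [dist_eq_norm, ← map_sub]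
    exact h2.trans_lt h3
  obtain ⟨w, hw⟩ := cauchySeq_tendsto_of_complete hcauchy
  obtain ⟨x, -, rfl⟩ := exists_vec_eq_of_tendsto (Eventually.of_forall haC) hw
  refine ⟨x, C, map (fun n => (a n, b n)) atTop, inferInstance, ?_, ?_, ?_, hw, ?_⟩
  · exact eventually_map.2 <| Eventually.of_forall ha
  · exact eventually_map.2 <| Eventually.of_forall haC
  · exact eventually_map.2 <| Eventually.of_forall fun n => (hb n).2
  · rw [tendsto_map'_iff]
    exact hlim.congr fun n => (hbv n).symm

/-- A trace preserving correspondence between generating `*`-subalgebras extends to a trace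
preserving `*`-isomorphism. -/
theorem exists_starAlgEquiv (hD : ∀ p ∈ D, P.τ p.1 = Q.τ p.2) (hn : ∀ p ∈ D, ‖p.1‖ = ‖p.2‖)
    (hP : ∀ x : P.Alg, ∃ C : ℝ, P.vec x ∈ closure (P.vec '' {a | (∃ b, (a, b) ∈ D) ∧ ‖a‖ ≤ C}))
    (hQ : ∀ y : Q.Alg, ∃ C : ℝ, Q.vec y ∈ closure (Q.vec '' {b | (∃ a, (a, b) ∈ D) ∧ ‖b‖ ≤ C})) :
    ∃ Ψ : P.Alg ≃⋆ₐ[ℂ] Q.Alg, (∀ a, Q.τ (Ψ a) = P.τ a) ∧ ∀ p ∈ D, Ψ p.1 = p.2 := by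
  choose F hF using fun x => exists_isCommonLimit_left hD hn (hP x).choose_spec
  choose G hG using fun y => exists_isCommonLimit_right hD hn (hQ y).choose_spec
  -- Partners are unique and the relation respects the operations, so the chosen function is a
  -- `*`-homomorphism.
  have huniq : ∀ {x y}, IsCommonLimit D x y → F x = y := fun {x y} h =>
    ((hF x).eq_iff hD h).1 rfl
  refine ⟨
    { toFun := F
      invFun := G
      left_inv := fun x => ((hG (F x)).eq_iff hD (hF x)).2 rfl
      right_inv := fun y => huniq (hG y)
      map_mul' := fun x y => huniq ((hF x).mul (hF y))
      map_add' := fun x y => huniq ((hF x).add (hF y))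
      map_star' := fun x => huniq (hF x).star
      map_smul' := fun c x => huniq ((hF x).smul c) }, fun a => ((hF a).trace_eq hD).symm,
    fun p hp => huniq (.of_mem hp)⟩

end CommonLimit

end WStarProbabilitySpace

theorem VonNeumannAlgebra.continuous_wot_inner {H : Type*} [NormedAddCommGroup H]
    [InnerProductSpace ℂ H] [CompleteSpace H] (M : VonNeumannAlgebra H) (ξ η : H) :
    @Continuous _ _ M.wot _
      (fun a : M.toStarSubalgebra => inner ℂ ξ ((a : H →L[ℂ] H) η)) := by
  have h : Continuous fun T : H →WOT[ℂ] H => inner ℂ ξ (T η) :=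
    ContinuousLinearMapWOT.continuous_iff.1 continuous_id η ξ
  exact @Continuous.comp _ _ _ M.wot _ _ _ (fun T : H →WOT[ℂ] H => inner ℂ ξ (T η)) h
    continuous_induced_dom

/-! ### The `W*`-probability space of a tracial state. -/

section TracialVonNeumannAlgebra

namespace IsTracialState

open Filter Topology

variable {A : Type u} [Ring A] [StarRing A] [Algebra ℂ A] [StarModule ℂ A] {τ : A →ₗ[ℂ] ℂ}
  (h : IsTracialState τ)

/-- The von Neumann algebra on `L²(A, τ)` generated by the left multiplications. -/
noncomputable def vonNeumann : VonNeumannAlgebra h.L2 := h.rep.range.bicommutant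

theorem rep_mem_vonNeumann (a : A) : h.rep a ∈ h.vonNeumann :=
  h.rep.range.subset_bicommutant ⟨a, rfl⟩

theorem isStrongLimit_of_mem_vonNeumann {T : h.L2 →L[ℂ] h.L2} (hT : T ∈ h.vonNeumann) :
    IsStrongLimit (Set.range h.rep) T := by
  rw [← SetLike.mem_coe, vonNeumann, StarSubalgebra.coe_bicommutant] at hT
  exact h.rep.range.isStrongLimit_of_mem_centralizer_centralizer hT

theorem vonNeumann_isGeneratedBy : h.vonNeumann.IsGeneratedBy (Set.range h.rep) :=
  ⟨h.rep.range.subset_bicommutant, fun _ hN => h.rep.range.bicommutant_le hN⟩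

theorem inner_vec_one_rep_mul (x : A) {T : h.L2 →L[ℂ] h.L2} (hT : T ∈ h.vonNeumann) :
    inner ℂ (h.vec 1) (h.rep x (T (h.vec 1))) = inner ℂ (h.vec 1) (T (h.rep x (h.vec 1))) := by
  obtain ⟨l, hl, hA, hlim⟩ := h.isStrongLimit_of_mem_vonNeumann hT
  have h1 := (tendsto_const_nhds (x := h.vec 1)).inner (𝕜 := ℂ)
    (((h.rep x).continuous.tendsto _).comp (hlim (h.vec 1)))
  have h2 := (tendsto_const_nhds (x := h.vec 1)).inner (𝕜 := ℂ) (hlim (h.rep x (h.vec 1)))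
  refine tendsto_nhds_unique h1 (h2.congr' ?_)
  filter_upwards [hA]
  rintro _ ⟨a, rfl⟩
  simp [rep_vec, inner_vec, h.tracial]

/-- The tracial property is extended to one factor at a time, since multiplication is only
separately continuous for strong limits. -/
theorem inner_vec_one_mul {S T : h.L2 →L[ℂ] h.L2} (hS : S ∈ h.vonNeumann)
    (hT : T ∈ h.vonNeumann) :
    inner ℂ (h.vec 1) (S (T (h.vec 1))) = inner ℂ (h.vec 1) (T (S (h.vec 1))) := by
  obtain ⟨l, hl, hA, hlim⟩ := h.isStrongLimit_of_mem_vonNeumann hT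
  have h1 := (tendsto_const_nhds (x := h.vec 1)).inner (𝕜 := ℂ)
    ((S.continuous.tendsto _).comp (hlim (h.vec 1)))
  have h2 := (tendsto_const_nhds (x := h.vec 1)).inner (𝕜 := ℂ) (hlim (S (h.vec 1)))
  refine tendsto_nhds_unique h1 (h2.congr' ?_)
  filter_upwards [hA]
  rintro _ ⟨a, rfl⟩
  exact h.inner_vec_one_rep_mul a hS

theorem inner_vec_one_star_mul_self (T : h.L2 →L[ℂ] h.L2) :
    inner ℂ (h.vec 1) ((star T * T) (h.vec 1)) = ((‖T (h.vec 1)‖ ^ 2 : ℝ) : ℂ) := by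
  rw [mul_apply_eq_comp, ContinuousLinearMap.star_eq_adjoint,
    ContinuousLinearMap.adjoint_inner_right, inner_self_eq_norm_sq_to_K]
  norm_cast

/-- For `b` in `A`, the trace property moves `b` to the front: `‖T b 1‖² = ⟪1, b* T* T b 1⟫ = ⟪1, b
b* T* T 1⟫ = 0`, and the vectors `b 1` are dense. -/
theorem eq_zero_of_apply_vec_one {T : h.L2 →L[ℂ] h.L2} (hT : T ∈ h.vonNeumann)
    (h0 : T (h.vec 1) = 0) : T = 0 := by
  refine h.clm_ext fun b => ?_
  have h1 := h.inner_vec_one_star_mul_self (T * h.rep b)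
  have h2 := h.inner_vec_one_mul (S := star (h.rep b) * (star T * T)) (T := h.rep b)
    (mul_mem (star_mem (h.rep_mem_vonNeumann b)) (mul_mem (star_mem hT) hT))
    (h.rep_mem_vonNeumann b)
  simp only [mul_apply_eq_comp, h0, map_zero, inner_zero_right, star_mul] at h1 h2
  rw [h2] at h1
  have h3 : ‖T (h.rep b (h.vec 1))‖ = 0 := by
    have := Complex.ofReal_eq_zero.1 h1.symm
    exact pow_eq_zero_iff (two_ne_zero) |>.1 this
  rw [rep_vec, mul_one] at h3
  simpa using h3

/-- The vector functional given by the trace vector. -/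
noncomputable def vonNeumannTrace : h.vonNeumann.toStarSubalgebra →ₗ[ℂ] ℂ where
  toFun x := inner ℂ (h.vec 1) ((x : h.L2 →L[ℂ] h.L2) (h.vec 1))
  map_add' x y := by simp
  map_smul' c x := by simp

theorem vonNeumannTrace_apply (x : h.vonNeumann.toStarSubalgebra) :
    h.vonNeumannTrace x = inner ℂ (h.vec 1) ((x : h.L2 →L[ℂ] h.L2) (h.vec 1)) := rfl

theorem vonNeumannTrace_mul_comm (x y : h.vonNeumann.toStarSubalgebra) :
    h.vonNeumannTrace (x * y) = h.vonNeumannTrace (y * x) := by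
  rw [vonNeumannTrace_apply, vonNeumannTrace_apply]
  exact h.inner_vec_one_mul x.2 y.2

theorem vonNeumannTrace_star_mul_self_pos {x : h.vonNeumann.toStarSubalgebra} (hx : x ≠ 0) :
    0 < h.vonNeumannTrace (star x * x) := by
  have h1 : (x : h.L2 →L[ℂ] h.L2) (h.vec 1) ≠ 0 := fun h0 =>
    hx (Subtype.ext (h.eq_zero_of_apply_vec_one x.2 h0))
  have h2 : h.vonNeumannTrace (star x * x) =
      ((‖(x : h.L2 →L[ℂ] h.L2) (h.vec 1)‖ ^ 2 : ℝ) : ℂ) :=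
    h.inner_vec_one_star_mul_self (x : h.L2 →L[ℂ] h.L2)
  rw [h2, Complex.zero_lt_real]
  exact pow_pos (norm_pos_iff.2 h1) 2

theorem continuous_vonNeumannTrace :
    @Continuous _ _ h.vonNeumann.wot _ h.vonNeumannTrace :=
  h.vonNeumann.continuous_wot_inner (h.vec 1) (h.vec 1)

theorem vonNeumannTrace_one : h.vonNeumannTrace 1 = 1 := by
  rw [vonNeumannTrace_apply, OneMemClass.coe_one, one_apply_eq_self, inner_vec, star_one, mul_one,
    h.map_one]

/-- The `W*`-probability space generated by a `*`-algebra with a tracial state. -/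
noncomputable def toWStarProbabilitySpace : WStarProbabilitySpace.{u} where
  H := h.L2
  M := h.vonNeumann
  τ := h.vonNeumannTrace
  normal := @Continuous.continuousOn _ _ h.vonNeumann.wot _ _ _ h.continuous_vonNeumannTrace
  faithful _ := h.vonNeumannTrace_star_mul_self_pos
  tracial := h.vonNeumannTrace_mul_comm
  map_one := h.vonNeumannTrace_one

/-- The canonical map from `A` to the generated `W*`-probability space. -/
noncomputable def toAlg : A →⋆ₐ[ℂ] h.toWStarProbabilitySpace.Alg :=
  StarAlgHom.codRestrict h.rep h.vonNeumann.toStarSubalgebra h.rep_mem_vonNeumann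

theorem trace_toAlg (a : A) : h.toWStarProbabilitySpace.τ (h.toAlg a) = τ a := by
  change inner ℂ (h.vec 1) (h.rep a (h.vec 1)) = τ a
  simp [rep_vec, inner_vec]

theorem toWStarProbabilitySpace_isGeneratedBy :
    h.toWStarProbabilitySpace.M.IsGeneratedBy
      (Set.range fun a =>
        (h.toAlg a : h.toWStarProbabilitySpace.H →L[ℂ] h.toWStarProbabilitySpace.H)) :=
  h.vonNeumann_isGeneratedBy

end IsTracialState

end TracialVonNeumannAlgebra

/-! ### The tracial state on the algebraic direct limit. -/

section DirectLimit

variable {S : Type u} [PartialOrder S] [IsDirectedOrder S] [Nonempty S] {G : S → Type v}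
  [∀ s, Ring (G s)] [∀ s, StarRing (G s)] [∀ s, Algebra ℂ (G s)]
  (Φ : ∀ s t : S, s ≤ t → (G s →⋆ₐ[ℂ] G t)) [DirectedSystem G (Φ · · ·)]

/-- The canonical maps into the direct limit of `*`-algebras. -/
noncomputable def DirectLimit.starAlgHomOf (s : S) : G s →⋆ₐ[ℂ] DirectLimit G Φ :=
  { DirectLimit.Algebra.of (R := ℂ) G Φ s with
    map_star' := fun _ => (DirectLimit.star_def ..).symm }

/-- The limit of a compatible family of tracial states. -/
noncomputable def DirectLimit.trace (τ : ∀ s, G s →ₗ[ℂ] ℂ)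
    (hτ : ∀ s t hst a, τ t (Φ s t hst a) = τ s a) : DirectLimit G Φ →ₗ[ℂ] ℂ :=
  DirectLimit.Module.lift ℂ S G Φ τ hτ

/-- The constant in `hb` must serve all `t ≥ s` at once: left multiplication by the class of `x`
meets vectors from every later stage. -/
theorem DirectLimit.isTracialState_trace (τ : ∀ s, G s →ₗ[ℂ] ℂ)
    (hτ : ∀ s t hst a, τ t (Φ s t hst a) = τ s a) (h : ∀ s, IsTracialState (τ s))
    (hb : ∀ s (x : G s), ∃ C : ℝ, 0 ≤ C ∧ ∀ t hst (a : G t),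
      (τ t (star (Φ s t hst x * a) * (Φ s t hst x * a))).re ≤ C ^ 2 * (τ t (star a * a)).re) :
    IsTracialState (DirectLimit.trace Φ τ hτ) where
  nonneg := DirectLimit.induction _ fun s a => by
    rw [DirectLimit.star_def, DirectLimit.mul_def]
    exact (h s).nonneg a
  tracial := DirectLimit.induction₂ _ fun s a b => by
    rw [DirectLimit.mul_def, DirectLimit.mul_def]
    exact (h s).tracial a b
  map_one := by
    rw [DirectLimit.one_def (Classical.arbitrary S)]
    exact (h _).map_one
  bounded := DirectLimit.induction _ fun s x => by
    obtain ⟨C, hC, hx⟩ := hb s x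
    refine ⟨C, hC, DirectLimit.induction _ fun t a => ?_⟩
    obtain ⟨r, hsr, htr⟩ := exists_ge_ge s t
    rw [DirectLimit.eq_of_le (f := Φ) ⟨s, x⟩ r hsr, DirectLimit.eq_of_le (f := Φ) ⟨t, a⟩ r htr]
    simp only [DirectLimit.mul_def, DirectLimit.star_def]
    exact hx r hsr _

end DirectLimit

/-- An inverse commutes with whatever commutes with the element. This is used to place resolvents in
a given von Neumann algebra. -/
theorem VonNeumannAlgebra.mem_of_mul_eq_one {H : Type*} [NormedAddCommGroup H]
    [InnerProductSpace ℂ H] [CompleteSpace H] (N : VonNeumannAlgebra H) {b r : H →L[ℂ] H}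
    (hb : b ∈ N) (hbr : b * r = 1) (hrb : r * b = 1) : r ∈ N := by
  rw [← SetLike.mem_coe, ← N.centralizer_centralizer]
  intro z hz
  calc z * r = r * b * z * r := by rw [hrb, one_mul]
    _ = r * (b * z) * r := by noncomm_ring
    _ = r * (z * b) * r := by rw [hz b hb]
    _ = r * z * (b * r) := by noncomm_ring
    _ = r * z := by rw [hbr, mul_one]

namespace WStarProbabilitySpace

open Filter Topology

theorem nontrivial_alg (P : WStarProbabilitySpace.{u}) : Nontrivial P.Alg := by
  refine ⟨⟨1, 0, fun h => ?_⟩⟩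
  have h1 := P.map_one
  rw [h, map_zero] at h1
  exact zero_ne_one h1

/-! ### Existence of inductive limits. -/

section Limit

variable {S : Type u} [PartialOrder S] {M : S → WStarProbabilitySpace.{v}}
  {Φ : ∀ s t : S, s ≤ t → ((M s).Alg →⋆ₐ[ℂ] (M t).Alg)}

theorem isInductiveLimit_of_trace_comp {L : WStarProbabilitySpace.{w}}
    {ι : ∀ s : S, (M s).Alg →⋆ₐ[ℂ] L.Alg}
    (hτ : ∀ s (a : (M s).Alg), L.τ (ι s a) = (M s).τ a)
    (hι : ∀ s t (hst : s ≤ t), (ι t).comp (Φ s t hst) = ι s)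
    (hgen : L.M.IsGeneratedBy
      (⋃ s, Set.range fun a : (M s).Alg => (ι s a : L.H →L[ℂ] L.H))) :
    IsInductiveLimit M Φ L ι :=
  ⟨fun s => injective_of_trace_comp (hτ s), fun s => isNormal_of_trace_comp (hτ s), hτ, hι, hgen⟩

section Existence

/-- `Φ s s` is idempotent and, preserving the trace, injective; hence it is the identity. -/
theorem directedSystem_of_trace_comp
    (hΦτ : ∀ (s t : S) (hst : s ≤ t) (a : (M s).Alg), (M t).τ (Φ s t hst a) = (M s).τ a)
    (hΦcomp : ∀ (r s t : S) (hrs : r ≤ s) (hst : s ≤ t),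
      (Φ s t hst).comp (Φ r s hrs) = Φ r t (hrs.trans hst)) :
    DirectedSystem (fun s => (M s).Alg) (Φ · · ·) where
  map_self s a := injective_of_trace_comp (hΦτ s s le_rfl)
    (DFunLike.congr_fun (hΦcomp s s s le_rfl le_rfl) a)
  map_map _ _ _ hrs hst a := DFunLike.congr_fun (hΦcomp _ _ _ hrs hst) a

theorem exists_isInductiveLimit_of_nonempty [IsDirectedOrder S] [Nonempty S]
    (hΦτ : ∀ (s t : S) (hst : s ≤ t) (a : (M s).Alg), (M t).τ (Φ s t hst a) = (M s).τ a)
    (hΦcomp : ∀ (r s t : S) (hrs : r ≤ s) (hst : s ≤ t),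
      (Φ s t hst).comp (Φ r s hrs) = Φ r t (hrs.trans hst)) :
    ∃ (L : WStarProbabilitySpace.{max u v}) (ι : ∀ s : S, (M s).Alg →⋆ₐ[ℂ] L.Alg),
      IsInductiveLimit M Φ L ι := by
  have := directedSystem_of_trace_comp hΦτ hΦcomp
  -- The norm `‖x‖` is a uniform constant because the connecting maps are isometric.
  have h := DirectLimit.isTracialState_trace Φ (fun s => (M s).τ) hΦτ
    (fun s => (M s).isTracialState) (fun s x => ⟨‖x‖, norm_nonneg _, fun t hst a => by
      rw [← norm_map_of_trace_comp (hΦτ s t hst) x]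
      exact (M t).trace_star_mul_mul_le _ a⟩)
  refine ⟨h.toWStarProbabilitySpace, fun s => h.toAlg.comp (DirectLimit.starAlgHomOf Φ s),
    isInductiveLimit_of_trace_comp (fun s a => h.trace_toAlg _) (fun s t hst => ?_) ?_⟩
  · refine StarAlgHom.ext fun a => congrArg h.toAlg ?_
    exact (DirectLimit.eq_of_le (f := Φ) ⟨s, a⟩ t hst).symm
  · convert h.toWStarProbabilitySpace_isGeneratedBy using 1
    refine Set.Subset.antisymm (Set.iUnion_subset fun s => ?_) ?_
    · rintro _ ⟨a, rfl⟩
      exact ⟨_, rfl⟩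
    · rintro _ ⟨a, rfl⟩
      induction a using DirectLimit.induction with
      | _ s a => exact Set.mem_iUnion.2 ⟨s, a, rfl⟩

/-- With nothing to generate from, the limit is the algebra of scalars, contained in every von
Neumann algebra. Functions on `PUnit` place `ℂ` in the required universe. -/
theorem exists_isInductiveLimit_of_isEmpty [IsEmpty S] :
    ∃ (L : WStarProbabilitySpace.{w}) (ι : ∀ s : S, (M s).Alg →⋆ₐ[ℂ] L.Alg),
      IsInductiveLimit M Φ L ι := by
  let τ : (PUnit.{w + 1} → ℂ) →ₗ[ℂ] ℂ := LinearMap.proj PUnit.unit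
  have h : IsTracialState τ :=
    { nonneg := fun a => star_mul_self_nonneg (a PUnit.unit)
      tracial := fun a b => mul_comm (a PUnit.unit) (b PUnit.unit)
      map_one := rfl
      bounded := fun x => ⟨‖x PUnit.unit‖, norm_nonneg _, fun a => le_of_eq <| by
        simp only [τ, LinearMap.proj_apply, Pi.mul_apply, Pi.star_apply, Complex.star_def, map_mul]
        rw [← Complex.normSq_eq_conj_mul_self, ← map_mul, ← Complex.normSq_eq_conj_mul_self,
          Complex.ofReal_re, Complex.ofReal_re, Complex.normSq_mul, Complex.normSq_eq_norm_sq,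
          Complex.normSq_eq_norm_sq]⟩ }
  refine ⟨h.toWStarProbabilitySpace, fun s => isEmptyElim s,
    isInductiveLimit_of_trace_comp (fun s => isEmptyElim s) (fun s => isEmptyElim s) ?_⟩
  refine ⟨by simp, fun N _ => h.toWStarProbabilitySpace_isGeneratedBy.2 ?_⟩
  rintro _ ⟨a, rfl⟩
  have h1 : a = algebraMap ℂ _ (a PUnit.unit) := funext fun _ => rfl
  rw [h1]
  change ((h.toAlg (algebraMap ℂ _ (a PUnit.unit))).1) ∈ N.toStarSubalgebra
  rw [AlgHomClass.commutes]
  exact N.toStarSubalgebra.algebraMap_mem _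

end Existence

/-! ### Uniqueness and transport of inductive limits. -/

section Uniqueness

/-- The `*`-subalgebra formed by the union of the ranges of a directed family of
`*`-homomorphisms. -/
def iUnionRange [IsDirectedOrder S] [Nonempty S] {B : Type*} [Ring B] [StarRing B] [Algebra ℂ B]
    [StarModule ℂ B] (ψ : ∀ s, (M s).Alg →⋆ₐ[ℂ] B)
    (hψ : ∀ s t hst a, ψ t (Φ s t hst a) = ψ s a) : StarSubalgebra ℂ B where
  carrier := {b | ∃ s a, ψ s a = b}
  add_mem' := by
    rintro _ _ ⟨s, a, rfl⟩ ⟨t, b, rfl⟩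
    obtain ⟨r, hsr, htr⟩ := exists_ge_ge s t
    exact ⟨r, Φ s r hsr a + Φ t r htr b, by rw [map_add, hψ, hψ]⟩
  mul_mem' := by
    rintro _ _ ⟨s, a, rfl⟩ ⟨t, b, rfl⟩
    obtain ⟨r, hsr, htr⟩ := exists_ge_ge s t
    exact ⟨r, Φ s r hsr a * Φ t r htr b, by rw [map_mul, hψ, hψ]⟩
  algebraMap_mem' c := ⟨Classical.arbitrary S, algebraMap ℂ _ c, AlgHomClass.commutes _ _⟩
  star_mem' := by
    rintro _ ⟨s, a, rfl⟩
    exact ⟨s, star a, map_star _ _⟩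

variable {L : WStarProbabilitySpace.{w}} {L' : WStarProbabilitySpace.{w'}}

theorem exists_starAlgEquiv_of_isGeneratedBy (D : StarSubalgebra ℂ (L.Alg × L'.Alg))
    (hD : ∀ p ∈ D, L.τ p.1 = L'.τ p.2) (hn : ∀ p ∈ D, ‖p.1‖ = ‖p.2‖)
    (hr : ∀ p ∈ D, IsSelfAdjoint p → ∃ r ∈ D, (1 + p * p) * r = 1)
    {X : Set (L.H →L[ℂ] L.H)} (hX : L.M.IsGeneratedBy X)
    (hXD : ∀ x ∈ X, ∃ p ∈ D, (p.1 : L.H →L[ℂ] L.H) = x)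
    {X' : Set (L'.H →L[ℂ] L'.H)} (hX' : L'.M.IsGeneratedBy X')
    (hXD' : ∀ x ∈ X', ∃ p ∈ D, (p.2 : L'.H →L[ℂ] L'.H) = x) :
    ∃ Ψ : L.Alg ≃⋆ₐ[ℂ] L'.Alg, (∀ a, L'.τ (Ψ a) = L.τ a) ∧ ∀ p ∈ D, Ψ p.1 = p.2 := by
  -- Equality of norms on `D`, applied to `star p - p`, makes either component self-adjoint when the
  -- other is. Resolvents of pairs thus give resolvents in both projections of `D`.
  have hsa : ∀ p ∈ D, IsSelfAdjoint p.1 ↔ IsSelfAdjoint p.2 := fun p hp => by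
    have h1 := hn _ (sub_mem (star_mem hp) hp)
    simp only [Prod.fst_sub, Prod.snd_sub, Prod.fst_star, Prod.snd_star] at h1
    rw [isSelfAdjoint_iff, isSelfAdjoint_iff, ← sub_eq_zero, ← norm_eq_zero, h1, norm_eq_zero,
      sub_eq_zero]
  refine exists_starAlgEquiv hD hn (fun x => ?_) (fun y => ?_)
  · have h1 := exists_mem_closure_vec hX (D.map (StarAlgHom.fst ℂ L.Alg L'.Alg)) (fun x hx => ?_)
      ?_ x
    · obtain ⟨C, hC⟩ := h1
      refine ⟨C, closure_mono (Set.image_mono ?_) hC⟩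
      rintro _ ⟨⟨p, hp, rfl⟩, hpC⟩
      exact ⟨⟨p.2, hp⟩, hpC⟩
    · obtain ⟨p, hp, rfl⟩ := hXD x hx
      exact ⟨p.1, ⟨p, hp, rfl⟩, rfl⟩
    · rintro _ ⟨p, hp, rfl⟩ hpsa
      obtain ⟨r, hrD, hr'⟩ := hr p hp (Prod.ext hpsa ((hsa p hp).1 hpsa))
      exact ⟨r.1, ⟨r, hrD, rfl⟩, congrArg Prod.fst hr'⟩
  · have h1 := exists_mem_closure_vec hX' (D.map (StarAlgHom.snd ℂ L.Alg L'.Alg)) (fun x hx => ?_)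
      ?_ y
    · obtain ⟨C, hC⟩ := h1
      refine ⟨C, closure_mono (Set.image_mono ?_) hC⟩
      rintro _ ⟨⟨p, hp, rfl⟩, hpC⟩
      exact ⟨⟨p.1, hp⟩, hpC⟩
    · obtain ⟨p, hp, rfl⟩ := hXD' x hx
      exact ⟨p.2, ⟨p, hp, rfl⟩, rfl⟩
    · rintro _ ⟨p, hp, rfl⟩ hpsa
      obtain ⟨r, hrD, hr'⟩ := hr p hp (Prod.ext ((hsa p hp).2 hpsa) hpsa)
      exact ⟨r.2, ⟨r, hrD, rfl⟩, congrArg Prod.snd hr'⟩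

variable {ι : ∀ s : S, (M s).Alg →⋆ₐ[ℂ] L.Alg} {ι' : ∀ s : S, (M s).Alg →⋆ₐ[ℂ] L'.Alg}

namespace IsInductiveLimit

theorem exists_starAlgEquiv_of_nonempty [IsDirectedOrder S] [Nonempty S]
    (h : IsInductiveLimit M Φ L ι) (h' : IsInductiveLimit M Φ L' ι') :
    ∃ Ψ : L.Alg ≃⋆ₐ[ℂ] L'.Alg, (∀ a, L'.τ (Ψ a) = L.τ a) ∧
      ∀ (s : S) (a : (M s).Alg), Ψ (ι s a) = ι' s a := by
  let D : StarSubalgebra ℂ (L.Alg × L'.Alg) :=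
    iUnionRange (Φ := Φ) (fun s => (ι s).prod (ι' s)) fun s t hst a =>
      Prod.ext (DFunLike.congr_fun (h.comp_eq s t hst) a)
        (DFunLike.congr_fun (h'.comp_eq s t hst) a)
  have hmem : ∀ s (a : (M s).Alg), (ι s a, ι' s a) ∈ D := fun s a => ⟨s, a, rfl⟩
  refine (exists_starAlgEquiv_of_isGeneratedBy D ?_ ?_ ?_ h.generates ?_
    h'.generates ?_).imp fun Ψ hΨ => ⟨hΨ.1, fun s a => hΨ.2 _ (hmem s a)⟩
  · rintro _ ⟨s, a, rfl⟩
    exact (h.trace_comp s a).trans (h'.trace_comp s a).symm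
  · rintro _ ⟨s, a, rfl⟩
    exact (norm_map_of_trace_comp (h.trace_comp s) a).trans
      (norm_map_of_trace_comp (h'.trace_comp s) a).symm
  · rintro _ ⟨s, a, rfl⟩ hsa
    -- The resolvent is formed inside `M s` and then mapped into both limits.
    have ha : IsSelfAdjoint a := h.injective s
      ((map_star (ι s) a).trans (congrArg Prod.fst hsa))
    obtain ⟨r, hr⟩ := (M s).exists_one_add_sq_mul_eq_one ha
    refine ⟨_, hmem s r, ?_⟩
    have := congrArg ((ι s).prod (ι' s)) hr
    rwa [map_mul, map_add, map_mul, _root_.map_one] at this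
  · intro x hx
    obtain ⟨s, a, rfl⟩ := Set.mem_iUnion.1 hx
    exact ⟨_, hmem s a, rfl⟩
  · intro x hx
    obtain ⟨s, a, rfl⟩ := Set.mem_iUnion.1 hx
    exact ⟨_, hmem s a, rfl⟩

theorem exists_starAlgEquiv_of_isEmpty [IsEmpty S]
    (h : IsInductiveLimit M Φ L ι) (h' : IsInductiveLimit M Φ L' ι') :
    ∃ Ψ : L.Alg ≃⋆ₐ[ℂ] L'.Alg, (∀ a, L'.τ (Ψ a) = L.τ a) ∧
      ∀ (s : S) (a : (M s).Alg), Ψ (ι s a) = ι' s a := by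
  have := L.nontrivial_alg
  have := L'.nontrivial_alg
  have hmem : ∀ p, p ∈ (⊥ : StarSubalgebra ℂ (L.Alg × L'.Alg)) ↔
      ∃ z : ℂ, (z • (1 : L.Alg), z • (1 : L'.Alg)) = p := fun p => by
    rw [StarSubalgebra.mem_bot]
    simp only [Set.mem_range, Algebra.algebraMap_eq_smul_one]
    rfl
  refine (exists_starAlgEquiv_of_isGeneratedBy
    (⊥ : StarSubalgebra ℂ (L.Alg × L'.Alg)) ?_ ?_ ?_ h.generates (by simp) h'.generates
    (by simp)).imp fun Ψ hΨ => ⟨hΨ.1, fun s => isEmptyElim s⟩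
  · intro p hp
    obtain ⟨z, rfl⟩ := (hmem p).1 hp
    rw [map_smul, map_smul, L.map_one, L'.map_one]
  · intro p hp
    obtain ⟨z, rfl⟩ := (hmem p).1 hp
    rw [norm_smul, norm_smul, CStarRing.norm_one, CStarRing.norm_one]
  · intro p hp hsa
    obtain ⟨z, rfl⟩ := (hmem p).1 hp
    have hsa' : IsSelfAdjoint (z • (1 : L.Alg)) := congrArg Prod.fst hsa
    obtain ⟨r, hr⟩ := L.exists_one_add_sq_mul_eq_one hsa'
    have h1 : (1 : L.Alg) + z • 1 * z • 1 = (1 + z * z) • 1 := by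
      rw [add_smul, one_smul, smul_mul_smul_comm, one_mul]
    -- Invertibility of `1 + (z • 1)²` in the nontrivial algebra `L.Alg` rules out `z² = -1`.
    have hz : 1 + z * z ≠ 0 := fun h0 => by
      rw [h1, h0, zero_smul, zero_mul] at hr
      exact zero_ne_one hr
    refine ⟨_, (hmem _).2 ⟨(1 + z * z)⁻¹, rfl⟩, Prod.ext ?_ ?_⟩
    · change ((1 : L.Alg) + z • 1 * z • 1) * (1 + z * z)⁻¹ • 1 = 1
      rw [h1, smul_mul_smul_comm, mul_inv_cancel₀ hz, one_smul, one_mul]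
    · change ((1 : L'.Alg) + z • 1 * z • 1) * (1 + z * z)⁻¹ • 1 = 1
      have h2 : (1 : L'.Alg) + z • 1 * z • 1 = (1 + z * z) • 1 := by
        rw [add_smul, one_smul, smul_mul_smul_comm, one_mul]
      rw [h2, smul_mul_smul_comm, mul_inv_cancel₀ hz, one_smul, one_mul]

/-- Inductive limits are preserved by trace preserving `*`-isomorphisms. -/
theorem map_starAlgEquiv (h : IsInductiveLimit M Φ L ι) (Ψ : L.Alg ≃⋆ₐ[ℂ] L'.Alg)
    (hΨ : ∀ a, L'.τ (Ψ a) = L.τ a) :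
    IsInductiveLimit M Φ L' fun s => (Ψ : L.Alg →⋆ₐ[ℂ] L'.Alg).comp (ι s) := by
  refine isInductiveLimit_of_trace_comp (fun s a => (hΨ _).trans (h.trace_comp s a))
    (fun s t hst => ?_) ?_
  · refine StarAlgHom.ext fun a => ?_
    exact congrArg Ψ (DFunLike.congr_fun (h.comp_eq s t hst) a)
  set X : Set (L'.H →L[ℂ] L'.H) := ⋃ s, Set.range fun a : (M s).Alg =>
    ((Ψ : L.Alg →⋆ₐ[ℂ] L'.Alg).comp (ι s) a : L'.H →L[ℂ] L'.H) with hX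
  have hXM : X ⊆ L'.M := by
    refine Set.iUnion_subset fun s => ?_
    rintro _ ⟨a, rfl⟩
    exact Subtype.property _
  -- The preimage `A` of `N₀` under `Ψ` contains the generators of `L` and is closed under
  -- resolvents, so it is boundedly `L²`-dense in `L`. Applying `Ψ`, isometric in both norms, gives
  -- bounded `L²`-density of `N₀ ∩ L'.M` in `L'.M`.
  let N₀ : VonNeumannAlgebra L'.H := (StarAlgebra.adjoin ℂ X).bicommutant
  have hXN₀ : X ⊆ N₀ := (StarAlgebra.subset_adjoin ℂ X).trans
    (StarSubalgebra.subset_bicommutant _)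
  have hN₀ : ∀ N : VonNeumannAlgebra L'.H, X ⊆ N → N₀ ≤ N := fun N hN =>
    StarSubalgebra.bicommutant_le _ (StarAlgebra.adjoin_le (S := N.toStarSubalgebra) hN)
  let A : StarSubalgebra ℂ L.Alg := N₀.toStarSubalgebra.comap
    (L'.M.toStarSubalgebra.subtype.comp (Ψ : L.Alg →⋆ₐ[ℂ] L'.Alg))
  have hA : ∀ a, a ∈ A ↔ (Ψ a : L'.H →L[ℂ] L'.H) ∈ N₀ := fun a => Iff.rfl
  have hdense := exists_mem_closure_vec h.generates A (fun x hx => by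
    obtain ⟨s, a, rfl⟩ := Set.mem_iUnion.1 hx
    exact ⟨ι s a, (hA _).2 (hXN₀ (Set.mem_iUnion.2 ⟨s, a, rfl⟩)), rfl⟩) (fun a ha hsa => by
    obtain ⟨r, hr⟩ := L.exists_one_add_sq_mul_eq_one hsa
    refine ⟨r, ?_, hr⟩
    have hb : 1 + a * a ∈ A := add_mem (one_mem A) (mul_mem ha ha)
    have hr' : r * (1 + a * a) = 1 := by
      have h1 : star r * (1 + a * a) = 1 := by
        have := congrArg star hr
        rwa [star_mul, star_add, star_mul, star_one, hsa.star_eq] at this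
      rwa [← left_inv_eq_right_inv h1 hr]
    exact N₀.mem_of_mul_eq_one ((hA _).1 hb)
      (congrArg Subtype.val (by rw [← map_mul, hr, _root_.map_one] : Ψ (1 + a * a) * Ψ r = 1))
      (congrArg Subtype.val (by rw [← map_mul, hr', _root_.map_one] : Ψ r * Ψ (1 + a * a) = 1)))
  refine isGeneratedBy_of_mem_closure_vec hXM {y | (y : L'.H →L[ℂ] L'.H) ∈ N₀}
    (fun N hN y hy => hN₀ N hN hy) fun y => ?_
  obtain ⟨C, hC⟩ := hdense (Ψ.symm y)
  refine ⟨C, ?_⟩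
  obtain ⟨v, hv, hlim⟩ := mem_closure_iff_seq_limit.1 hC
  choose a ha hav using hv
  have hΨ' : ∀ a, L'.τ ((Ψ : L.Alg →⋆ₐ[ℂ] L'.Alg) a) = L.τ a := hΨ
  refine mem_closure_of_tendsto (f := fun n => L'.vec (Ψ (a n))) (b := Filter.atTop) ?_
    (Filter.Eventually.of_forall fun n => ⟨_, ⟨(ha n).1,
      (norm_map_of_trace_comp hΨ' (a n)).trans_le (ha n).2⟩, rfl⟩)
  rw [tendsto_iff_norm_sub_tendsto_zero] at hlim ⊢
  refine hlim.congr fun n => ?_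
  rw [← hav, ← map_sub, ← norm_vec_map hΨ', ← map_sub]
  congr 2
  change Ψ (a n - Ψ.symm y) = _
  rw [map_sub, StarAlgEquiv.apply_symm_apply]

end IsInductiveLimit

end Uniqueness

end Limit

end WStarProbabilitySpace

theorem mainTheorem12 {S : Type u} [PartialOrder S] [IsDirectedOrder S]
    (M : S → WStarProbabilitySpace.{v})
    (Φ : ∀ s t : S, s ≤ t → ((M s).Alg →⋆ₐ[ℂ] (M t).Alg))
    (hΦτ : ∀ (s t : S) (hst : s ≤ t) (a : (M s).Alg), (M t).τ (Φ s t hst a) = (M s).τ a)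
    (hΦcomp : ∀ (r s t : S) (hrs : r ≤ s) (hst : s ≤ t),
      (Φ s t hst).comp (Φ r s hrs) = Φ r t (hrs.trans hst)) :
    -- existence of an inductive limit
    (∃ (L : WStarProbabilitySpace.{max u v}) (ι : ∀ s : S, (M s).Alg →⋆ₐ[ℂ] L.Alg),
      WStarProbabilitySpace.IsInductiveLimit M Φ L ι) ∧
    -- any two inductive limits are isomorphic by a trace preserving *-isomorphism
    (∀ (L : WStarProbabilitySpace.{w}) (ι : ∀ s : S, (M s).Alg →⋆ₐ[ℂ] L.Alg)
      (L' : WStarProbabilitySpace.{w'}) (ι' : ∀ s : S, (M s).Alg →⋆ₐ[ℂ] L'.Alg),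
      WStarProbabilitySpace.IsInductiveLimit M Φ L ι →
      WStarProbabilitySpace.IsInductiveLimit M Φ L' ι' →
      ∃ Ψ : L.Alg ≃⋆ₐ[ℂ] L'.Alg,
        (∀ a : L.Alg, L'.τ (Ψ a) = L.τ a) ∧
        (∀ (s : S) (a : (M s).Alg), Ψ (ι s a) = ι' s a)) ∧
    -- whatever is isomorphic to an inductive limit in this way is one
    (∀ (L : WStarProbabilitySpace.{w}) (ι : ∀ s : S, (M s).Alg →⋆ₐ[ℂ] L.Alg)
      (L' : WStarProbabilitySpace.{w'}) (Ψ : L.Alg ≃⋆ₐ[ℂ] L'.Alg),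
      WStarProbabilitySpace.IsInductiveLimit M Φ L ι →
      (∀ a : L.Alg, L'.τ (Ψ a) = L.τ a) →
      WStarProbabilitySpace.IsInductiveLimit M Φ L'
        (fun s => (Ψ : L.Alg →⋆ₐ[ℂ] L'.Alg).comp (ι s))) := by
  refine ⟨?_, fun L ι L' ι' h h' => ?_, fun L ι L' Ψ h hΨ => h.map_starAlgEquiv Ψ hΨ⟩
  · cases isEmpty_or_nonempty S
    · exact WStarProbabilitySpace.exists_isInductiveLimit_of_isEmpty
    · exact WStarProbabilitySpace.exists_isInductiveLimit_of_nonempty hΦτ hΦcomp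
  · cases isEmpty_or_nonempty S
    · exact h.exists_starAlgEquiv_of_isEmpty h'
    · exact h.exists_starAlgEquiv_of_nonempty h'
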